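/- Let $m,n>0$ be real. Let $\Delta$ be the open unit disc. For $p>0$ let $H^p=H^p(\Delta)$ be the space of holomorphic differentials $f(z)(dz)^p$ on $\Delta$, identified with the holomorphic functions $f=\sum_k f_kz^k$ on $\Delta$ with the topology of uniform convergence on compact sets (and its Borel structure). Put $\beta_p(k)=\frac{\Gamma(k+1)\Gamma(2p)}{\Gamma(2p+k)}$ and let $H^p\cap L^2$ be the Hilbert space of those $f\in H^p$ with $|f|^2=\sum_k\beta_p(k)|f_k|^2<\infty$, with inner product $\langle f,g\rangle_p=\sum_k\beta_p(k)f_k\overline{g_k}$. Let $\tilde G$ be the universal covering of $PSU(1,1)$, i.e. the set of triples $(a,b,A)\in\mathbb C^3$ with $|a|^2-|b|^2=1$, $e^A=a$, acting on $H^p$ by $f(z)\mapsto f\big(\frac{\bar az-b}{-\bar bz+a}\big)e^{-2pA}\big(1-\frac{\bar b}{a}z\big)^{-2p}$ (principal power). There is a unique injective continuous linear $\tilde G$-equivariant map $F\mapsto B(m,n;F)$ from $H^{m+n}\cap L^2$ into $(H^m\cap L^2)\otimes(H^n\cap L^2)$ that sends $(dz)^{m+n}$ to $(dz)^m\otimes(dz)^n$.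 Here the tensor product is the space of Hilbert–Schmidt operators from the complex conjugate $\overline{H^m\cap L^2}$ to $H^n\cap L^2$, with $u\otimes v$ acting by $\bar f\mapsto\langle u,f\rangle_m\,v$. Thus $B(m,n;F)B(m,n;F)^*$ is a positive trace class operator on $H^n\cap L^2$ and the Fredholm determinant $\det(1+B(m,n;F)B(m,n;F)^*)$ is defined (the series of principal minors in the orthonormal basis $\beta_n(k)^{-1/2}z^k(dz)^n$ is summable). (a) For every integer $j\ge1$ the function $$F\mapsto\det\big(1+B(m,n;F)B(m,n;F)^*\big)^{-j}$$ on $H^{m+n}\cap L^2$ is positive definite, i.e. all matrices of its values at $F_i-F_k$, for finitely many $F_1,\dots,F_N\in H^{m+n}\cap L^2$, are positive semidefinite. (b) For $p,T>0$ let $\nu^{(p)}_T$ be the Gaussian probability measure on $H^p$ for which the Taylor coefficients $f_k$ are independent with densities $\frac{\beta_p(k)}{2\pi T}e^{-\beta_p(k)|f_k|^2/(2T)}$ with respect to Lebesgue measure on $\mathbb C$. For $S,T>0$ let $\nu^{(m)}_S\otimes\nu^{(n)}_T$ be the image of the product measure under the multiplication $H^m\times H^n\to H^{m+n}$, $(f,g)\mapsto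 fg$; it is a probability measure. Its Fourier transform $$F\mapsto\int e^{-i\,\mathrm{Re}\langle F,f\rangle_{m+n}}\,d(\nu^{(m)}_S\otimes\nu^{(n)}_T)(f),$$ defined for polynomial differentials $F\in H^{m+n}$ (for which the sum $\langle F,f\rangle_{m+n}$ is finite for all $f\in H^{m+n}$), extends, uniquely, to a continuous function on the Hilbert space $H^{m+n}\cap L^2$. -/

import Mathlib

namespace HoloDiff

open Complex MeasureTheory ProbabilityTheory
open scoped Nat NNReal ENNReal ComplexConjugate

noncomputable section

/-! ### Holomorphic differentials on the unit disc -/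

/-- The open unit disc `Δ`. -/
abbrev Disc : Set ℂ := Metric.ball (0 : ℂ) 1

open Classical in
/-- Extension by zero of a function on the disc. -/
def extZero (f : C(Disc, ℂ)) (z : ℂ) : ℂ := if h : z ∈ Disc then f ⟨z, h⟩ else 0

theorem extZero_of_mem (f : C(Disc, ℂ)) {z : ℂ} (h : z ∈ Disc) : extZero f z = f ⟨z, h⟩ :=
  dif_pos h

theorem differentiableOn_extZero {f : C(Disc, ℂ)} {F : ℂ → ℂ} (hF : DifferentiableOn ℂ F Disc)
    (h : ∀ z : Disc, f z = F z) : DifferentiableOn ℂ (extZero f) Disc :=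
  hF.congr fun z hz => by rw [extZero_of_mem f hz, h ⟨z, hz⟩]

/-- The subspace of holomorphic functions in `C(Δ, ℂ)`. -/
def holSubmodule : Submodule ℂ C(Disc, ℂ) where
  carrier := {f | DifferentiableOn ℂ (extZero f) Disc}
  add_mem' {f g} hf hg := differentiableOn_extZero (DifferentiableOn.add hf hg) fun z => by
    simp [extZero_of_mem _ z.2]
  zero_mem' := differentiableOn_extZero (F := fun _ => 0) (differentiableOn_const 0) fun z => by
    simp
  smul_mem' c f hf := differentiableOn_extZero (DifferentiableOn.const_smul hf c) fun z => by
    simp [extZero_of_mem _ z.2]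

/-- The holomorphic functions on `Δ`.  A differential `f(z)(dz)^m` is identified with `f`, so that
this is the underlying space of `H^m(Δ)` for every degree `m`.  As a subspace of `C(Δ, ℂ)` with the
compact-open topology it carries the topology of uniform convergence on compact sets. -/
abbrev Hol : Type := holSubmodule

instance : MeasurableSpace Hol := borel Hol

instance : BorelSpace Hol := ⟨rfl⟩

namespace Hol

/-- A function that is holomorphic on the disc, as an element of `Hol`. -/
def mk (F : ℂ → ℂ) (hF : DifferentiableOn ℂ F Disc) : Hol :=
  ⟨⟨fun z : Disc => F z, hF.continuousOn.domRestrict⟩, differentiableOn_extZero hF fun _ => rfl⟩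

/-- The value at a point of the plane (zero outside the disc). -/
def eval (f : Hol) : ℂ → ℂ := extZero f.1

theorem differentiableOn_eval (f : Hol) : DifferentiableOn ℂ (eval f) Disc := f.2

theorem eval_mk (F : ℂ → ℂ) (hF : DifferentiableOn ℂ F Disc) {z : ℂ} (hz : z ∈ Disc) :
    eval (mk F hF) z = F z := extZero_of_mem _ hz

theorem eval_add (f g : Hol) {z : ℂ} (hz : z ∈ Disc) :
    eval (f + g) z = eval f z + eval g z := by
  simp [eval, extZero_of_mem _ hz]

theorem eval_smul (c : ℂ) (f : Hol) {z : ℂ} (hz : z ∈ Disc) :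
    eval (c • f) z = c * eval f z := by
  simp [eval, extZero_of_mem _ hz]

theorem ext_eval {f g : Hol} (h : ∀ z ∈ Disc, eval f z = eval g z) : f = g := by
  apply Subtype.ext
  ext z
  have := h z z.2
  simpa [eval, extZero_of_mem _ z.2] using this

/-- The `k`-th Taylor coefficient at the origin. -/
def coeff (f : Hol) (k : ℕ) : ℂ := (k ! : ℂ)⁻¹ * iteratedDeriv k (eval f) 0

theorem hasSum_coeff (f : Hol) {z : ℂ} (hz : z ∈ Disc) :
    HasSum (fun k => coeff f k * z ^ k) (eval f z) := by
  have := Complex.hasSum_taylorSeries_on_ball (c := (0 : ℂ)) (r := 1) f.differentiableOn_eval hz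
  convert! this using 2 with k
  simp only [coeff, sub_zero, smul_eq_mul]
  ring

theorem radius_of_summable {a : ℕ → ℂ} (h : ∀ z ∈ Disc, Summable fun k => a k * z ^ k) :
    1 ≤ (FormalMultilinearSeries.ofScalars ℂ a).radius := by
  refine ENNReal.le_of_forall_nnreal_lt fun r hr => ?_
  have hr1 : r < 1 := by exact_mod_cast hr
  have hz : ((r : ℝ) : ℂ) ∈ Disc := by
    simpa [Disc] using hr1
  refine FormalMultilinearSeries.le_radius_of_summable _ ?_
  have := (h _ hz).norm
  simpa [FormalMultilinearSeries.ofScalars_norm] using this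

theorem hasFPowerSeries_of_hasSum {a : ℕ → ℂ} {f : ℂ → ℂ}
    (h : ∀ z ∈ Disc, HasSum (fun k => a k * z ^ k) (f z)) :
    HasFPowerSeriesOnBall f (FormalMultilinearSeries.ofScalars ℂ a) 0 1 where
  r_le := radius_of_summable fun z hz => (h z hz).summable
  r_pos := one_pos
  hasSum {y} hy := by
    have hy' : y ∈ Disc := by
      have : Metric.eball (0 : ℂ) 1 = Disc := by
        rw [← ENNReal.ofReal_one, Metric.eball_ofReal]
      rwa [this] at hy
    simpa [FormalMultilinearSeries.ofScalars_apply_eq, mul_comm] using h y hy'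

theorem coeff_eq_of_hasSum {a : ℕ → ℂ} {f : Hol}
    (h : ∀ z ∈ Disc, HasSum (fun k => a k * z ^ k) (eval f z)) : coeff f = a := by
  have h1 := (hasFPowerSeries_of_hasSum h).hasFPowerSeriesAt
  have h2 := (hasFPowerSeries_of_hasSum fun z hz => f.hasSum_coeff hz).hasFPowerSeriesAt
  exact FormalMultilinearSeries.ofScalars_series_injective ℂ ℂ (h2.eq_formalMultilinearSeries h1)

theorem coeff_add (f g : Hol) (k : ℕ) : coeff (f + g) k = coeff f k + coeff g k := by
  have : coeff (f + g) = fun k => coeff f k + coeff g k := coeff_eq_of_hasSum fun z hz => by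
    rw [eval_add f g hz]
    simpa only [add_mul] using (f.hasSum_coeff hz).add (g.hasSum_coeff hz)
  rw [this]

theorem coeff_smul (c : ℂ) (f : Hol) (k : ℕ) : coeff (c • f) k = c * coeff f k := by
  have : coeff (c • f) = fun k => c * coeff f k := coeff_eq_of_hasSum fun z hz => by
    rw [eval_smul c f hz]
    simpa only [mul_assoc] using (f.hasSum_coeff hz).mul_left c
  rw [this]

theorem coeff_injective : Function.Injective coeff := fun f g h => ext_eval fun z hz => by
  have h1 := f.hasSum_coeff hz
  rw [h] at h1
  exact h1.unique (g.hasSum_coeff hz)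

open Classical in
/-- The sum of the power series `∑ aₖ zᵏ` if it converges on the whole disc, and zero otherwise. -/
def ofCoeff (a : ℕ → ℂ) : Hol :=
  if h : ∀ z ∈ Disc, Summable fun k => a k * z ^ k then
    mk (fun z => ∑' k, a k * z ^ k) <| by
      have := (hasFPowerSeries_of_hasSum fun z hz => (h z hz).hasSum).differentiableOn
      rwa [← ENNReal.ofReal_one, Metric.eball_ofReal] at this
  else 0

theorem coeff_ofCoeff {a : ℕ → ℂ} (h : ∀ z ∈ Disc, Summable fun k => a k * z ^ k) :
    coeff (ofCoeff a) = a := coeff_eq_of_hasSum fun z hz => by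
  rw [ofCoeff, dif_pos h, eval_mk _ _ hz]
  exact (h z hz).hasSum

/-- The product of two holomorphic functions: the multiplication `H^m × H^n → H^{m+n}`. -/
def mul (f g : Hol) : Hol :=
  mk (fun z => eval f z * eval g z) (f.differentiableOn_eval.mul g.differentiableOn_eval)

/-- The constant function `1`, that is, the differential `(dz)^m`. -/
def one : Hol := mk (fun _ => 1) (differentiableOn_const 1)

theorem coeff_one (k : ℕ) : coeff one k = if k = 0 then 1 else 0 := by
  have : coeff one = fun k => if k = 0 then 1 else 0 := coeff_eq_of_hasSum fun z hz => by
    rw [one, eval_mk _ _ hz]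
    convert! hasSum_single (f := fun k => (if k = 0 then (1 : ℂ) else 0) * z ^ k) 0 ?_ using 1
    · simp
    · intro k hk; simp [hk]
  rw [this]

end Hol

/-! ### The group and its action -/

/-- The universal covering of the group of conformal automorphisms of the disc: pairs of a matrix
`(a, b; conj b, conj a)` in `SU(1,1)` and a logarithm `A` of `a`. -/
structure CoverG where
  a : ℂ
  b : ℂ
  A : ℂ
  det_eq : ‖a‖ ^ 2 - ‖b‖ ^ 2 = 1
  exp_eq : exp A = a

namespace CoverG

theorem norm_b_lt (g : CoverG) : ‖g.b‖ < ‖g.a‖ := by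
  have := g.det_eq
  nlinarith [norm_nonneg g.a, norm_nonneg g.b]

theorem a_ne (g : CoverG) : g.a ≠ 0 := by
  rw [← g.exp_eq]; exact exp_ne_zero _

theorem norm_lt (g : CoverG) {z : ℂ} (hz : z ∈ Disc) : ‖conj g.b / g.a * z‖ < 1 := by
  have h1 := g.norm_b_lt
  have ha : 0 < ‖g.a‖ := norm_pos_iff.2 g.a_ne
  have hz' : ‖z‖ < 1 := by simpa [Disc] using hz
  rw [norm_mul, norm_div, RCLike.norm_conj]
  have h2 : ‖g.b‖ / ‖g.a‖ < 1 := (div_lt_one ha).2 h1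
  have h3 : 0 ≤ ‖g.b‖ / ‖g.a‖ := by positivity
  nlinarith [norm_nonneg z]

theorem mem_slitPlane (g : CoverG) {z : ℂ} (hz : z ∈ Disc) :
    1 - conj g.b / g.a * z ∈ slitPlane := by
  left
  have := (re_le_norm (conj g.b / g.a * z)).trans_lt (g.norm_lt hz)
  rw [sub_re, one_re]
  linarith

theorem den_ne (g : CoverG) {z : ℂ} (hz : z ∈ Disc) : -conj g.b * z + g.a ≠ 0 := by
  have h := slitPlane_ne_zero (g.mem_slitPlane hz)
  have : -conj g.b * z + g.a = g.a * (1 - conj g.b / g.a * z) := by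
    field_simp [g.a_ne]
    ring
  rw [this]
  exact mul_ne_zero g.a_ne h

/-- The inverse of the linear fractional transformation: `z ↦ (conj a z - b) / (-conj b z + a)`. -/
def mobInv (g : CoverG) (z : ℂ) : ℂ := (conj g.a * z - g.b) / (-conj g.b * z + g.a)

theorem mobInv_mem (g : CoverG) {z : ℂ} (hz : z ∈ Disc) : g.mobInv z ∈ Disc := by
  have hden := g.den_ne hz
  have hz' : ‖z‖ < 1 := by simpa [Disc] using hz
  have key : ‖-conj g.b * z + g.a‖ ^ 2 - ‖conj g.a * z - g.b‖ ^ 2 = 1 - ‖z‖ ^ 2 := by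
    have h := g.det_eq
    have e : ‖-conj g.b * z + g.a‖ ^ 2 - ‖conj g.a * z - g.b‖ ^ 2
        = (‖g.a‖ ^ 2 - ‖g.b‖ ^ 2) * (1 - ‖z‖ ^ 2) := by
      simp only [← normSq_eq_norm_sq, normSq_apply, add_re, add_im, sub_re, sub_im, mul_re, mul_im,
        neg_re, neg_im, conj_re, conj_im]
      ring
    rw [e, h, one_mul]
  have hlt : ‖conj g.a * z - g.b‖ < ‖-conj g.b * z + g.a‖ := by
    apply lt_of_pow_lt_pow_left₀ 2 (norm_nonneg _)
    nlinarith [norm_nonneg z]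
  simp only [mobInv, Disc, mem_ball_zero_iff, norm_div]
  exact (div_lt_one ((norm_nonneg _).trans_lt hlt)).2 hlt

/-- The action on differentials of degree `m`:
`f(z) ↦ f((conj a z - b) / (-conj b z + a)) (a - conj b z)^{-2m}`, where
`(a - conj b z)^{-2m} = e^{-2mA} (1 - (conj b / a) z)^{-2m}` with the principal power. -/
def act (m : ℝ) (g : CoverG) (f : Hol) : Hol :=
  Hol.mk (fun z => exp (-2 * m * g.A) * (1 - conj g.b / g.a * z) ^ (-2 * m : ℂ)
      * f.eval (g.mobInv z)) <| by
    refine DifferentiableOn.mul (DifferentiableOn.const_mul ?_ _) ?_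
    · refine DifferentiableOn.cpow_const (by fun_prop) fun z hz => g.mem_slitPlane hz
    · refine f.differentiableOn_eval.comp ?_ fun z hz => g.mobInv_mem hz
      refine DifferentiableOn.div (by fun_prop) (by fun_prop) fun z hz => g.den_ne hz

end CoverG

/-! ### The Hilbert spaces `H^m ∩ L²` -/

/-- The coefficient `Γ(k+1) Γ(2m) / Γ(2m+k) = k! / ((2m)(2m+1)⋯(2m+k-1))` of `|f_k|²` in the
invariant norm of `f = ∑ f_k z^k (dz)^m`. -/
def wt (m : ℝ) (k : ℕ) : ℝ :=
  Real.Gamma (k + 1) * Real.Gamma (2 * m) / Real.Gamma (2 * m + k)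

theorem wt_pos {m : ℝ} (hm : 0 < m) (k : ℕ) : 0 < wt m k := by
  have h1 := Real.Gamma_pos_of_pos (show (0 : ℝ) < k + 1 by positivity)
  have h2 := Real.Gamma_pos_of_pos (show (0 : ℝ) < 2 * m by positivity)
  have h3 := Real.Gamma_pos_of_pos (show (0 : ℝ) < 2 * m + k by positivity)
  unfold wt
  positivity

theorem wt_zero {m : ℝ} (hm : 0 < m) : wt m 0 = 1 := by
  have h2 := Real.Gamma_pos_of_pos (show (0 : ℝ) < 2 * m by positivity)
  simp [wt, h2.ne']

theorem wt_succ {m : ℝ} (hm : 0 < m) (k : ℕ) :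
    wt m (k + 1) = wt m k * ((k + 1) / (k + 2 * m)) := by
  have h3 := Real.Gamma_pos_of_pos (show (0 : ℝ) < 2 * m + k by positivity)
  have e1 : Real.Gamma ((k + 1 : ℕ) + 1) = (k + 1) * Real.Gamma (k + 1) := by
    push_cast
    exact Real.Gamma_add_one (by positivity)
  have e2 : Real.Gamma (2 * m + (k + 1 : ℕ)) = (2 * m + k) * Real.Gamma (2 * m + k) := by
    push_cast
    rw [← add_assoc]
    exact Real.Gamma_add_one (by positivity)
  have h4 : (k : ℝ) + 2 * m ≠ 0 := by positivity
  have h5 : 2 * m + (k : ℝ) ≠ 0 := by positivity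
  unfold wt
  rw [e1, e2]
  field_simp
  ring

theorem summable_wt {m : ℝ} (hm : 0 < m) {r : ℝ} (h0 : 0 < r) (h1 : r < 1) :
    Summable fun k => (√(wt m k))⁻¹ * r ^ k := by
  have hpos : ∀ k, 0 < (√(wt m k))⁻¹ * r ^ k := fun k => by
    have := wt_pos hm k
    positivity
  refine summable_of_ratio_test_tendsto_lt_one (l := r) h1
    (Filter.Eventually.of_forall fun k => (hpos k).ne') ?_
  have hlim : Filter.Tendsto (fun k : ℕ => ((k : ℝ) + 1) / (k + 2 * m)) Filter.atTop (nhds 1) := by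
    have := tendsto_add_mul_div_add_mul_atTop_nhds (1 : ℝ) (2 * m) 1 (one_ne_zero)
    simpa [add_comm] using this
  have hlim2 : Filter.Tendsto (fun k : ℕ => (√(((k : ℝ) + 1) / (k + 2 * m)))⁻¹ * r) Filter.atTop
      (nhds r) := by
    have := ((hlim.sqrt).inv₀ (by simp)).mul_const r
    simpa using this
  refine hlim2.congr fun k => ?_
  have hk := wt_pos hm k
  have hq : (0 : ℝ) < ((k : ℝ) + 1) / (k + 2 * m) := by positivity
  rw [Real.norm_of_nonneg (hpos _).le, Real.norm_of_nonneg (hpos _).le, wt_succ hm,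
    Real.sqrt_mul hk.le]
  have : √(wt m k) ≠ 0 := by positivity
  have : √(((k : ℝ) + 1) / (k + 2 * m)) ≠ 0 := by positivity
  field_simp
  ring

/-- The subspace of those `f = ∑ f_k z^k` with `∑ (Γ(k+1) Γ(2m) / Γ(2m+k)) |f_k|² < ∞`. -/
def l2Submodule (m : ℝ) : Submodule ℂ Hol where
  carrier := {f | Memℓp (fun k => (√(wt m k) : ℂ) * f.coeff k) 2}
  add_mem' {f g} hf hg := by
    have e : (fun k => (√(wt m k) : ℂ) * (f + g).coeff k) =
        (fun k => (√(wt m k) : ℂ) * f.coeff k) + fun k => (√(wt m k) : ℂ) * g.coeff k := by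
      funext k
      simp [Hol.coeff_add, mul_add]
    change Memℓp _ 2
    rw [e]
    exact Memℓp.add hf hg
  zero_mem' := by
    have : (fun k => (√(wt m k) : ℂ) * Hol.coeff 0 k) = 0 := funext fun k => by
      have : Hol.coeff 0 k = 0 := by simpa using Hol.coeff_smul 0 0 k
      simp [this]
    change Memℓp _ 2
    rw [this]
    exact zero_memℓp
  smul_mem' c f hf := by
    have e : (fun k => (√(wt m k) : ℂ) * (c • f).coeff k) =
        c • fun k => (√(wt m k) : ℂ) * f.coeff k := by
      funext k
      simp [Hol.coeff_smul, mul_left_comm]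
    change Memℓp _ 2
    rw [e]
    exact Memℓp.const_smul hf c

/-- The Hilbert space `H^m ∩ L²`, `m > 0`, a linear subspace of `H^m(Δ)`. It is a separate type
since its topology is the one of its norm, not the subspace topology. -/
def HL2 (m : ℝ) : Type := l2Submodule m

namespace HL2

instance (m : ℝ) : AddCommGroup (l2Submodule m) :=
  @Submodule.addCommGroup ℂ Hol _ _ _ (l2Submodule m)

instance (m : ℝ) : AddCommGroup (HL2 m) := inferInstanceAs (AddCommGroup (l2Submodule m))

instance (m : ℝ) : Module ℂ (HL2 m) := inferInstanceAs (Module ℂ (l2Submodule m))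

/-- The inclusion of `H^m ∩ L²` into `H^m(Δ)`. -/
def toHol (m : ℝ) : HL2 m →ₗ[ℂ] Hol := (l2Submodule m).subtype

theorem toHol_injective (m : ℝ) : Function.Injective (toHol m) := Subtype.val_injective

theorem memℓp {m : ℝ} (f : HL2 m) : Memℓp (fun k => (√(wt m k) : ℂ) * (toHol m f).coeff k) 2 :=
  f.2

/-- The coordinates `√(wt m k) f_k` of `f` with respect to the vectors `z^k / √(wt m k)`. -/
def toEll (m : ℝ) : HL2 m →ₗ[ℂ] lp (fun _ : ℕ => ℂ) 2 where
  toFun f := ⟨fun k => (√(wt m k) : ℂ) * (toHol m f).coeff k, f.memℓp⟩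
  map_add' f g := by
    apply lp.ext
    funext k
    simp only [map_add, Hol.coeff_add, mul_add]
    rfl
  map_smul' c f := by
    apply lp.ext
    funext k
    simp [Hol.coeff_smul, mul_left_comm]

theorem toEll_apply {m : ℝ} (f : HL2 m) (k : ℕ) :
    toEll m f k = (√(wt m k) : ℂ) * (toHol m f).coeff k := rfl

variable {m : ℝ} [hm : Fact (0 < m)]

theorem sqrt_wt_ne (k : ℕ) : (√(wt m k) : ℂ) ≠ 0 := by
  have := wt_pos hm.out k
  exact_mod_cast (Real.sqrt_pos.2 this).ne'

theorem toEll_bijective : Function.Bijective (toEll m) := by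
  constructor
  · intro f g h
    apply toHol_injective
    apply Hol.coeff_injective
    funext k
    have : toEll m f k = toEll m g k := by rw [h]
    rw [toEll_apply, toEll_apply] at this
    exact mul_left_cancel₀ (sqrt_wt_ne k) this
  · intro x
    have hs : ∀ z ∈ Disc, Summable fun k => ((√(wt m k) : ℂ)⁻¹ * x k) * z ^ k := by
      intro z hz
      have hz' : ‖z‖ < 1 := by simpa [Disc] using hz
      obtain ⟨r, hr, hr1⟩ := exists_between hz'
      have hr0 : 0 < r := (norm_nonneg z).trans_lt hr
      refine Summable.of_norm_bounded ((summable_wt hm.out hr0 hr1).mul_right ‖x‖) fun k => ?_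
      have hx : ‖x k‖ ≤ ‖x‖ := lp.norm_apply_le_norm (by simp) x k
      have hp : ‖z‖ ^ k ≤ r ^ k := pow_le_pow_left₀ (norm_nonneg z) hr.le k
      rw [norm_mul, norm_mul, norm_inv, norm_pow, norm_real, Real.norm_of_nonneg (Real.sqrt_nonneg _)]
      calc (√(wt m k))⁻¹ * ‖x k‖ * ‖z‖ ^ k ≤ (√(wt m k))⁻¹ * ‖x‖ * r ^ k := by gcongr
        _ = _ := by ring
    have hc := Hol.coeff_ofCoeff hs
    have e : (fun k => (√(wt m k) : ℂ) * (Hol.ofCoeff fun k => (√(wt m k) : ℂ)⁻¹ * x k).coeff k)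
        = x := by
      rw [hc]
      funext k
      exact mul_inv_cancel_left₀ (sqrt_wt_ne k) _
    refine ⟨⟨Hol.ofCoeff fun k => (√(wt m k) : ℂ)⁻¹ * x k, ?_⟩, ?_⟩
    · change Memℓp _ 2
      rw [e]
      exact lp.memℓp x
    · apply lp.ext
      exact e

instance : NormedAddCommGroup (HL2 m) :=
  NormedAddCommGroup.induced (HL2 m) (lp (fun _ : ℕ => ℂ) 2) (toEll m) toEll_bijective.1

/-- The inner product `⟪f, g⟫ = ∑ (Γ(k+1) Γ(2m) / Γ(2m+k)) conj(f_k) g_k`, conjugate linear in the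
first variable, transported from `ℓ²`. -/
instance : InnerProductSpace ℂ (HL2 m) where
  norm_smul_le c f := by
    change ‖toEll m (c • f)‖ ≤ ‖c‖ * ‖toEll m f‖
    rw [map_smul, norm_smul]
  inner f g := inner ℂ (toEll m f) (toEll m g)
  norm_sq_eq_re_inner f := norm_sq_eq_re_inner (𝕜 := ℂ) (toEll m f)
  conj_inner_symm f g := inner_conj_symm (toEll m f) (toEll m g)
  add_left f g h := by
    change inner ℂ (toEll m (f + g)) (toEll m h) = _
    rw [map_add, inner_add_left]
  smul_left f g c := by
    change inner ℂ (toEll m (c • f)) (toEll m g) = _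
    rw [map_smul, inner_smul_left]

/-- The isometry of `H^m ∩ L²` with `ℓ²` given by the coordinates `√(wt m k) f_k`. -/
def equivEll (m : ℝ) [Fact (0 < m)] : HL2 m ≃ₗᵢ[ℂ] lp (fun _ : ℕ => ℂ) 2 where
  toLinearEquiv := LinearEquiv.ofBijective (toEll m) toEll_bijective
  norm_map' _ := rfl

instance : CompleteSpace (HL2 m) :=
  (completeSpace_congr (e := (equivEll m).toLinearEquiv.toEquiv)
    (equivEll m).isometry.isUniformEmbedding).2 inferInstance

theorem inner_eq (f g : HL2 m) : inner ℂ f g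
    = ∑' k, wt m k * (conj ((toHol m f).coeff k) * (toHol m g).coeff k) := by
  change inner ℂ (toEll m f) (toEll m g) = _
  rw [lp.inner_eq_tsum]
  congr 1
  funext k
  rw [toEll_apply, toEll_apply, RCLike.inner_apply, map_mul, conj_ofReal]
  have : (wt m k : ℂ) = (√(wt m k) : ℂ) * (√(wt m k) : ℂ) := by
    rw [← ofReal_mul, Real.mul_self_sqrt (wt_pos hm.out k).le]
  rw [this]
  ring

/-- The orthonormal basis `z^k / √(wt m k)`, `k ≥ 0`, of `H^m ∩ L²`. -/
def monomialBasis (m : ℝ) [Fact (0 < m)] : HilbertBasis ℕ ℂ (HL2 m) := ⟨equivEll m⟩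

/-- The differential `(dz)^m` as an element of `H^m ∩ L²`. -/
def one (m : ℝ) : HL2 m := ⟨Hol.one, by
  change Memℓp _ 2
  refine memℓp_gen ?_
  refine summable_of_ne_finset_zero (s := {0}) fun k hk => ?_
  have : k ≠ 0 := by simpa using hk
  simp [Hol.coeff_one, this]⟩

end HL2

instance factAdd (m n : ℝ) [hm : Fact (0 < m)] [hn : Fact (0 < n)] : Fact (0 < m + n) :=
  ⟨add_pos hm.out hn.out⟩

/-! ### Conjugate linear operators: Hilbert-Schmidt condition, `B B*`, Fredholm determinant -/

section Operators

variable {E F : Type*} [NormedAddCommGroup E] [InnerProductSpace ℂ E] [CompleteSpace E]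
  [NormedAddCommGroup F] [InnerProductSpace ℂ F]

/-- A conjugate linear operator `C : E → F`, viewed as the linear operator `conj e ↦ C e` from the
conjugate space of `E` to `F`, is Hilbert-Schmidt. -/
def IsHilbertSchmidt (C : E →L⋆[ℂ] F) : Prop :=
  ∃ K : ℝ, ∀ (N : ℕ) (v : Fin N → E), Orthonormal ℂ v → ∑ i, ‖C (v i)‖ ^ 2 ≤ K

/-- The adjoint of a conjugate linear operator: `⟪C† g, f⟫ = ⟪C f, g⟫`. -/
def antiAdjoint (C : E →L⋆[ℂ] F) : F →L⋆[ℂ] E :=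
  ((InnerProductSpace.toDual ℂ E).symm.toContinuousLinearEquiv :
    StrongDual ℂ E →L⋆[ℂ] E).comp ((innerSL ℂ).comp C : E →L[ℂ] F →L[ℂ] ℂ).flip

theorem inner_antiAdjoint (C : E →L⋆[ℂ] F) (f : E) (g : F) :
    inner ℂ (antiAdjoint C g) f = inner ℂ (C f) g := by
  change inner ℂ ((InnerProductSpace.toDual ℂ E).symm _) f = _
  rw [InnerProductSpace.toDual_symm_apply]
  rfl

/-- The positive operator `B B*` on `F`, where `B` is the linear operator `conj e ↦ C e` from the
conjugate space of `E` to `F`. -/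
def mulStar (C : E →L⋆[ℂ] F) : F →L[ℂ] F := C.comp (antiAdjoint C)

theorem inner_mulStar (C : E →L⋆[ℂ] F) (g h : F) :
    inner ℂ g (mulStar C h) = inner ℂ (antiAdjoint C h) (antiAdjoint C g) := by
  rw [← inner_conj_symm, ← inner_conj_symm (antiAdjoint C h), inner_antiAdjoint]
  rfl

/-- The principal minor of `A` on the span of the basis vectors indexed by `s`. -/
def principalMinor {ι : Type*} [DecidableEq ι] (b : HilbertBasis ι ℂ F) (A : F →L[ℂ] F) (s : Finset ι) : ℂ :=
  (Matrix.of fun i j : s => inner ℂ (b i) (A (b j))).det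

/-- Fredholm's determinant `det(1 + A) = ∑ₖ tr(Λ^k A)` of a trace class operator `A`, the traces
being computed in an orthonormal basis. -/
def detOneAdd {ι : Type*} [DecidableEq ι] (b : HilbertBasis ι ℂ F) (A : F →L[ℂ] F) : ℂ :=
  ∑' s : Finset ι, principalMinor b A s

end Operators

/-! ### The operators `B(m,n;F)` -/

/-- `J` is a normalized `G̃`-equivariant embedding of `H^{m+n} ∩ L²` into
`(H^m ∩ L²) ⊗ (H^n ∩ L²)`, the latter being realized as the space of Hilbert-Schmidt operators from
the conjugate space of `H^m ∩ L²` to `H^n ∩ L²`, that is, of conjugate linear Hilbert-Schmidt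
operators from `H^m ∩ L²` to `H^n ∩ L²`, where `u ⊗ v` corresponds to `f ↦ ⟪f, u⟫ • v`. -/
structure IsEquivariantEmbedding (m n : ℝ) [Fact (0 < m)] [Fact (0 < n)]
    (J : HL2 (m + n) →L[ℂ] (HL2 m →L⋆[ℂ] HL2 n)) : Prop where
  hilbertSchmidt : ∀ F, IsHilbertSchmidt (J F)
  injective : Function.Injective J
  /-- `J` maps `(dz)^{m+n}` to `(dz)^m ⊗ (dz)^n`. -/
  map_one : ∀ f, J (HL2.one (m + n)) f = inner ℂ f (HL2.one m) • HL2.one n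
  /-- `J(g F)(conj (g f)) = g (J(F)(conj f))`. -/
  equivariant : ∀ (g : CoverG) (F F' : HL2 (m + n)) (f f' : HL2 m),
    HL2.toHol _ F' = g.act (m + n) (HL2.toHol _ F) → HL2.toHol _ f' = g.act m (HL2.toHol _ f) →
      HL2.toHol _ (J F' f') = g.act n (HL2.toHol _ (J F f))

/-- The embedding `F ↦ B(m,n;F)`: the normalized equivariant embedding of `H^{m+n} ∩ L²` into
`(H^m ∩ L²) ⊗ (H^n ∩ L²)`. -/
def genHankel (m n : ℝ) [Fact (0 < m)] [Fact (0 < n)] :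
    HL2 (m + n) →L[ℂ] (HL2 m →L⋆[ℂ] HL2 n) :=
  Classical.epsilon (IsEquivariantEmbedding m n)

/-- `det(1 + B(m,n;F) B(m,n;F)*)`. -/
def detB (m n : ℝ) [Fact (0 < m)] [Fact (0 < n)] (F : HL2 (m + n)) : ℂ :=
  detOneAdd (HL2.monomialBasis n) (mulStar (genHankel m n F))

open scoped ComplexOrder in
/-- Positive definite functions on an additive group: all matrices `(p(xᵢ - xⱼ))` are positive
semidefinite. -/
def IsPositiveDefinite {V : Type*} [AddCommGroup V] (p : V → ℂ) : Prop :=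
  ∀ (N : ℕ) (x : Fin N → V), (Matrix.of fun i j => p (x i - x j)).PosSemidef

/-! ### Gaussian measures, multiplication of measures, Fourier transform -/

/-- The centered Gaussian measure on `ℂ` with density `(2πv)⁻¹ exp(-|w|²/(2v))`: independent real
and imaginary parts of variance `v`. -/
def complexGaussian (v : ℝ≥0) : Measure ℂ :=
  ((gaussianReal 0 v).prod (gaussianReal 0 v)).map measurableEquivRealProd.symm

instance (v : ℝ≥0) : IsProbabilityMeasure (complexGaussian v) :=
  Measure.isProbabilityMeasure_map measurableEquivRealProd.symm.measurable.aemeasurable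

/-- The law of independent Taylor coefficients `f_k` with densities proportional to
`exp(-wt m k |f_k|²/(2T))`. -/
def gaussianCoeff (m T : ℝ) : Measure (ℕ → ℂ) :=
  Measure.infinitePi fun k => complexGaussian (T / wt m k).toNNReal

/-- The Gaussian measure `ν_T^{(m)}` on `H^m(Δ)`: the law of the random power series `∑ f_k z^k`
(which almost surely converges on the disc). -/
def gaussian (m T : ℝ) : Measure Hol := (gaussianCoeff m T).map Hol.ofCoeff

/-- The multiplicative image `ν ⊗ μ` of two measures: the image of the product measure under
multiplication. -/
def mulMeasure (ν μ : Measure Hol) : Measure Hol :=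
  (ν.prod μ).map fun p => Hol.mul p.1 p.2

/-- `H^m_alg`: the polynomial differentials. -/
def algSet (m : ℝ) : Set (HL2 m) := {F | {k | (HL2.toHol m F).coeff k ≠ 0}.Finite}

/-- The pairing `⟨F, f⟩ = ∑ wt m k F_k conj(f_k)` of a polynomial differential `F` and a
differential `f` in `H^m(Δ)`. -/
def pairing (m : ℝ) (F : HL2 m) (f : Hol) : ℂ :=
  ∑ᶠ k, wt m k * ((HL2.toHol m F).coeff k * conj (f.coeff k))

/-- The Fourier transform of a measure on `H^m(Δ)`, a function on the polynomial differentials. -/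
def fourier (m : ℝ) (ν : Measure Hol) (F : algSet m) : ℂ :=
  ∫ f, exp (-I * ((pairing m F f).re : ℂ)) ∂ν

end

end HoloDiff

namespace HoloDiff

open Complex MeasureTheory ProbabilityTheory
open scoped Nat NNReal ENNReal ComplexConjugate

noncomputable section

open Finset.HasAntidiagonal (antidiagonal mem_antidiagonal)

/-! Everything rests on one convolution identity: the numbers `(wt m k)⁻¹` are the Taylor
coefficients of `(1 - u)^(-2m)`, so convolving those for `m` and `n` gives those for `m + n`
(`sum_inv_wt_mul_inv_wt`). By Cauchy-Schwarz, multiplication of functions is then a contraction from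
`HL2 m × HL2 n` to `HL2 (m + n)`.

The operator `B(m,n;F)` is the adjoint of multiplication, `⟪g, B f⟫ = ⟪f g, F⟫` (`mulAdjoint`). The
same identity bounds its Hilbert-Schmidt norm by `‖F‖`. It is equivariant because multiplication is
equivariant and the group acts unitarily. It is the only choice because the group carries the
constant `1` to scalar multiples of all reproducing kernels, and these span a dense subspace.

For (a), let `c_r(F) = B(F)† e_r`, which is additive in `F`. A finite section of `1 + B B*` is `1`
plus a transposed Gram matrix of the `c_r(F)`, and its inverse determinant is, up to a power of `π`,
the Gaussian integral over `x` of `exp(-|x|²) exp(-‖∑ conj x_r c_r(F)‖²)`. For fixed `x` the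
integrand is a positive definite function of `F`, hence so is the integral
(`posSemidef_det_one_add_gram_inv`). The determinants of the finite sections converge because the
traces are bounded by `‖F‖²`, limits preserve positivity, and Schur's product theorem handles
powers.

For (b), write random `f` and `g` by their Taylor coefficients. The products `f_i g_j` are
orthogonal, and the convolution identity bounds the second moment of `⟨F, f g⟩` by `4 S T ‖F‖²`
(`integral_norm_pairing_sq_le`). Hence the Fourier transform is Lipschitz for the Hilbert norm on
the polynomials, which are dense, and it extends uniquely. -/

/-! ### The weights as inverse binomial coefficients. -/

theorem inv_wt {m : ℝ} (hm : 0 < m) (k : ℕ) :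
    (wt m k)⁻¹ = (-1) ^ k * Ring.choose (-2 * m) k := by
  induction k with
  | zero => simp [wt_zero hm]
  | succ k ih =>
    have h := Ring.choose_smul_choose (-2 * m) (Nat.le_succ k)
    simp only [Nat.succ_eq_add_one, Nat.choose_succ_self_right, nsmul_eq_mul,
      Nat.add_sub_cancel_left, Ring.choose_one_right] at h
    have h0 : ((k : ℝ) + 1) ≠ 0 := by positivity
    have h1 : ((k : ℝ) + 2 * m) ≠ 0 := by positivity
    have h2 : Ring.choose (-2 * m) (k + 1) = Ring.choose (-2 * m) k * (-2 * m - k) / (k + 1) := by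
      rw [eq_div_iff h0, mul_comm, ← h]
      push_cast
      ring
    rw [wt_succ hm, mul_inv, ih, h2]
    field_simp
    ring

/-- Chu-Vandermonde for the upper arguments `-2m` and `-2n`, the signs `(-1)^k` being multiplicative
along the antidiagonal. -/
theorem sum_inv_wt_mul_inv_wt {m n : ℝ} (hm : 0 < m) (hn : 0 < n) (k : ℕ) :
    ∑ p ∈ antidiagonal k, (wt m p.1)⁻¹ * (wt n p.2)⁻¹ = (wt (m + n) k)⁻¹ := by
  rw [inv_wt (add_pos hm hn), show -2 * (m + n) = -2 * m + -2 * n by ring,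
    Ring.add_choose_eq k (Commute.all _ _), Finset.mul_sum]
  refine Finset.sum_congr rfl fun p hp => ?_
  rw [inv_wt hm, inv_wt hn, ← mem_antidiagonal.1 hp, pow_add]
  ring

theorem hasSum_inv_wt {m : ℝ} (hm : 0 < m) {u : ℂ} (hu : ‖u‖ < 1) :
    HasSum (fun k => ((wt m k)⁻¹ : ℂ) * u ^ k) ((1 - u) ^ (-2 * m : ℂ)) := by
  have h := (Complex.one_add_cpow_hasFPowerSeriesOnBall_zero (a := (-2 * m : ℂ))).hasSum
    (y := -u) (by
      rw [← ENNReal.ofReal_one, Metric.eball_ofReal]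
      simpa using hu)
  simp only [zero_add, binomialSeries_apply, List.ofFn_const, List.prod_replicate,
    smul_eq_mul] at h
  rw [sub_eq_add_neg]
  refine h.congr_fun fun k => ?_
  rw [← ofReal_inv, inv_wt hm, ofReal_mul, Complex.ofReal_choose, neg_pow u]
  push_cast
  ring

/-! ### Products of power series and reproducing kernels. -/

namespace Hol

theorem coeff_mul (f g : Hol) (k : ℕ) :
    coeff (mul f g) k = ∑ p ∈ antidiagonal k, coeff f p.1 * coeff g p.2 := by
  have : coeff (mul f g) =
      fun k => ∑ p ∈ antidiagonal k, coeff f p.1 * coeff g p.2 := by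
    refine coeff_eq_of_hasSum fun z hz => ?_
    have hf := f.hasSum_coeff hz
    have hg := g.hasSum_coeff hz
    have hf' := hf.summable.norm
    have hg' := hg.summable.norm
    rw [mul, eval_mk _ _ hz, ← hf.tsum_eq, ← hg.tsum_eq,
      tsum_mul_tsum_eq_tsum_sum_antidiagonal_of_summable_norm hf' hg']
    have e : (fun k => (∑ p ∈ antidiagonal k, coeff f p.1 * coeff g p.2) * z ^ k) =
        fun k => ∑ p ∈ antidiagonal k, coeff f p.1 * z ^ p.1 * (coeff g p.2 * z ^ p.2) := by
      funext k
      rw [Finset.sum_mul]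
      refine Finset.sum_congr rfl fun p hp => ?_
      rw [← mem_antidiagonal.1 hp, pow_add]
      ring
    rw [e]
    exact (summable_norm_sum_mul_antidiagonal_of_summable_norm hf' hg').of_norm.hasSum
  rw [this]

theorem eval_mul (f g : Hol) {z : ℂ} (hz : z ∈ Disc) : eval (mul f g) z = eval f z * eval g z :=
  eval_mk _ _ hz

theorem coeff_zero (k : ℕ) : coeff 0 k = 0 := by
  simpa using coeff_smul 0 0 k

theorem norm_conj_mul_lt {w z : ℂ} (hw : w ∈ Disc) (hz : z ∈ Disc) : ‖conj w * z‖ < 1 := by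
  have hw' : ‖w‖ < 1 := by simpa [Disc] using hw
  have hz' : ‖z‖ < 1 := by simpa [Disc] using hz
  rw [norm_mul, RCLike.norm_conj]
  exact mul_lt_one_of_nonneg_of_lt_one_left (norm_nonneg _) hw' hz'.le

theorem one_sub_conj_mul_mem_slitPlane {w z : ℂ} (hw : w ∈ Disc) (hz : z ∈ Disc) :
    1 - conj w * z ∈ slitPlane := by
  rw [sub_eq_add_neg]
  exact mem_slitPlane_of_norm_lt_one (by simpa using norm_conj_mul_lt hw hz)

/-- The reproducing kernel `z ↦ (1 - conj w z)^(-2m)`. -/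
def kernel (m : ℝ) (w : Disc) : Hol :=
  mk (fun z => (1 - conj (w : ℂ) * z) ^ (-2 * m : ℂ)) <|
    DifferentiableOn.cpow_const (by fun_prop) fun _ hz => one_sub_conj_mul_mem_slitPlane w.2 hz

theorem eval_kernel (m : ℝ) (w : Disc) {z : ℂ} (hz : z ∈ Disc) :
    eval (kernel m w) z = (1 - conj (w : ℂ) * z) ^ (-2 * m : ℂ) := eval_mk _ _ hz

theorem coeff_kernel {m : ℝ} (hm : 0 < m) (w : Disc) (k : ℕ) :
    coeff (kernel m w) k = (wt m k : ℂ)⁻¹ * conj (w : ℂ) ^ k := by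
  have : coeff (kernel m w) = fun k => (wt m k : ℂ)⁻¹ * conj (w : ℂ) ^ k :=
    coeff_eq_of_hasSum fun z hz => by
      rw [eval_kernel m w hz]
      refine (hasSum_inv_wt hm (norm_conj_mul_lt w.2 hz)).congr_fun fun k => ?_
      rw [mul_pow]
      ring
  rw [this]

end Hol

namespace HL2

@[simp]
theorem toHol_one {m : ℝ} : toHol m (one m) = Hol.one := rfl

variable {m : ℝ} [hm : Fact (0 < m)]

theorem norm_sq_eq (f : HL2 m) :
    HasSum (fun k => wt m k * ‖(toHol m f).coeff k‖ ^ 2) (‖f‖ ^ 2) := by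
  have h := lp.hasSum_norm (p := 2) (by simp) (toEll m f)
  have e : ‖toEll m f‖ = ‖f‖ := rfl
  simp only [ENNReal.toReal_ofNat, Real.rpow_ofNat, e] at h
  refine h.congr_fun fun k => ?_
  rw [toEll_apply, norm_mul, mul_pow, norm_real, Real.norm_of_nonneg (Real.sqrt_nonneg _),
    Real.sq_sqrt (wt_pos hm.out k).le]

theorem memℓp_of_summable {f : Hol} (hf : Summable fun k => wt m k * ‖f.coeff k‖ ^ 2) :
    Memℓp (fun k => (√(wt m k) : ℂ) * f.coeff k) 2 := by
  refine memℓp_gen ?_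
  refine hf.congr fun k => ?_
  rw [ENNReal.toReal_ofNat, Real.rpow_ofNat, norm_mul, mul_pow, norm_real,
    Real.norm_of_nonneg (Real.sqrt_nonneg _), Real.sq_sqrt (wt_pos hm.out k).le]

/-- A holomorphic function with finite norm, as an element of `H^m ∩ L²`. -/
def ofHol (f : Hol) (hf : Summable fun k => wt m k * ‖f.coeff k‖ ^ 2) : HL2 m :=
  ⟨f, memℓp_of_summable hf⟩

theorem summable_kernel (w : Disc) :
    Summable fun k => wt m k * ‖(Hol.kernel m w).coeff k‖ ^ 2 := by
  have hw : ‖(w : ℂ)‖ < 1 := mem_ball_zero_iff.1 w.2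
  have h := (hasSum_inv_wt hm.out (u := (‖(w : ℂ)‖ ^ 2 : ℝ)) (by
    rw [norm_real, norm_pow, norm_norm]
    exact pow_lt_one₀ (norm_nonneg _) hw two_ne_zero)).summable.norm
  refine h.congr fun k => ?_
  have h0 := (wt_pos hm.out k)
  rw [Hol.coeff_kernel hm.out, norm_mul, norm_mul, norm_inv, norm_pow, norm_pow, RCLike.norm_conj,
    norm_real, norm_real, norm_pow, norm_norm, Real.norm_of_nonneg h0.le]
  field_simp
  ring

/-- The reproducing kernel as an element of `H^m ∩ L²`. -/
def kernel (m : ℝ) [Fact (0 < m)] (w : Disc) : HL2 m := ofHol (Hol.kernel m w) (summable_kernel w)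

@[simp]
theorem toHol_kernel (w : Disc) : toHol m (kernel m w) = Hol.kernel m w := rfl

theorem inner_kernel (w : Disc) (f : HL2 m) :
    inner ℂ (kernel m w) f = (toHol m f).eval w := by
  rw [inner_eq, ← ((toHol m f).hasSum_coeff w.2).tsum_eq]
  refine tsum_congr fun k => ?_
  have h0 : (wt m k : ℂ) ≠ 0 := by exact_mod_cast (wt_pos hm.out k).ne'
  rw [toHol_kernel, Hol.coeff_kernel hm.out, map_mul, map_inv₀, map_pow, conj_conj, conj_ofReal]
  field_simp

/-- The linear combinations of reproducing kernels. -/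
def kernelSum (m : ℝ) [Fact (0 < m)] : (Disc →₀ ℂ) →ₗ[ℂ] HL2 m :=
  Finsupp.linearCombination ℂ (kernel m)

/-- A vector orthogonal to every kernel vanishes at every point of the disc. -/
theorem denseRange_kernelSum : DenseRange (kernelSum m) := by
  have h : (Submodule.span ℂ (Set.range (kernel m))).topologicalClosure = ⊤ := by
    rw [Submodule.topologicalClosure_eq_top_iff, Submodule.eq_bot_iff]
    intro f hf
    refine toHol_injective m (Hol.ext_eval fun z hz => ?_)
    rw [Submodule.mem_orthogonal] at hf
    rw [← inner_kernel ⟨z, hz⟩, hf _ (Submodule.subset_span ⟨_, rfl⟩), map_zero]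
    simp [Hol.eval, extZero_of_mem _ hz]
  rw [← Finsupp.range_linearCombination] at h
  exact (Submodule.dense_iff_topologicalClosure_eq_top).2 h

theorem ext_inner_kernel {f g : HL2 m} (h : ∀ w, inner ℂ (kernel m w) f = inner ℂ (kernel m w) g) :
    f = g := by
  refine toHol_injective m (Hol.ext_eval fun z hz => ?_)
  rw [← inner_kernel ⟨z, hz⟩, h, inner_kernel]

end HL2

theorem hasSum_norm_inner_sq {ι E : Type*} [NormedAddCommGroup E] [InnerProductSpace ℂ E]
    (b : HilbertBasis ι ℂ E) (x : E) : HasSum (fun i => ‖inner ℂ (b i) x‖ ^ 2) (‖x‖ ^ 2) := by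
  have h := lp.hasSum_norm (p := 2) (by simp) (b.repr x)
  simpa only [ENNReal.toReal_ofNat, Real.rpow_ofNat, b.repr.norm_map, b.repr_apply_apply] using h

/-! ### Multiplication as a contraction, and its adjoint. -/

namespace HL2

variable {m n : ℝ} [hm : Fact (0 < m)] [hn : Fact (0 < n)]

/-- Cauchy-Schwarz on the antidiagonal with weights `wt m i * wt n j`; the sum of the inverse
weights is exactly `(wt (m + n) k)⁻¹`, so no constant is lost. -/
theorem wt_mul_norm_coeff_mul_sq_le (f g : Hol) (k : ℕ) :
    wt (m + n) k * ‖(Hol.mul f g).coeff k‖ ^ 2 ≤ ∑ p ∈ antidiagonal k,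
      (wt m p.1 * ‖f.coeff p.1‖ ^ 2) * (wt n p.2 * ‖g.coeff p.2‖ ^ 2) := by
  have hk := wt_pos (add_pos hm.out hn.out) k
  have h1 : ‖(Hol.mul f g).coeff k‖ ≤ ∑ p ∈ antidiagonal k, ‖f.coeff p.1‖ * ‖g.coeff p.2‖ := by
    rw [Hol.coeff_mul]
    exact (norm_sum_le _ _).trans_eq (Finset.sum_congr rfl fun p _ => norm_mul _ _)
  have h2 : (∑ p ∈ antidiagonal k, ‖f.coeff p.1‖ * ‖g.coeff p.2‖) ^ 2 ≤
      (∑ p ∈ antidiagonal k,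
        (wt m p.1 * ‖f.coeff p.1‖ ^ 2) * (wt n p.2 * ‖g.coeff p.2‖ ^ 2)) *
      ∑ p ∈ antidiagonal k, (wt m p.1)⁻¹ * (wt n p.2)⁻¹ := by
    refine Finset.sum_sq_le_sum_mul_sum_of_sq_le_mul _ (fun p _ => ?_) (fun p _ => ?_)
      fun p _ => ?_
    · have := wt_pos hm.out p.1
      have := wt_pos hn.out p.2
      positivity
    · have := wt_pos hm.out p.1
      have := wt_pos hn.out p.2
      positivity
    · have := wt_pos hm.out p.1
      have := wt_pos hn.out p.2
      refine le_of_eq ?_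
      field_simp
  rw [sum_inv_wt_mul_inv_wt hm.out hn.out] at h2
  have h3 := (pow_le_pow_left₀ (norm_nonneg _) h1 2).trans h2
  rw [← div_eq_mul_inv, le_div_iff₀ hk] at h3
  linarith

theorem hasSum_antidiagonal (f : HL2 m) (g : HL2 n) :
    HasSum (fun k => ∑ p ∈ antidiagonal k, (wt m p.1 * ‖(toHol m f).coeff p.1‖ ^ 2) *
      (wt n p.2 * ‖(toHol n g).coeff p.2‖ ^ 2)) (‖f‖ ^ 2 * ‖g‖ ^ 2) := by
  have hf := (norm_sq_eq f)
  have hg := (norm_sq_eq g)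
  have hf' := hf.summable.norm
  have hg' := hg.summable.norm
  rw [← hf.tsum_eq, ← hg.tsum_eq,
    tsum_mul_tsum_eq_tsum_sum_antidiagonal_of_summable_norm hf' hg']
  exact (summable_norm_sum_mul_antidiagonal_of_summable_norm hf' hg').of_norm.hasSum

theorem summable_mul (f : HL2 m) (g : HL2 n) : Summable fun k =>
    wt (m + n) k * ‖(Hol.mul (toHol m f) (toHol n g)).coeff k‖ ^ 2 :=
  (hasSum_antidiagonal f g).summable.of_nonneg_of_le
    (fun k => by have := wt_pos (add_pos hm.out hn.out) k; positivity)
    fun k => wt_mul_norm_coeff_mul_sq_le _ _ k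

/-- The product `(H^m ∩ L²) × (H^n ∩ L²) → H^{m+n} ∩ L²`. -/
def mul (f : HL2 m) (g : HL2 n) : HL2 (m + n) :=
  ofHol (Hol.mul (toHol m f) (toHol n g)) (summable_mul f g)

@[simp]
theorem toHol_mul (f : HL2 m) (g : HL2 n) :
    toHol (m + n) (mul f g) = Hol.mul (toHol m f) (toHol n g) := rfl

theorem norm_mul_le (f : HL2 m) (g : HL2 n) : ‖mul f g‖ ≤ ‖f‖ * ‖g‖ := by
  refine le_of_sq_le_sq ?_ (by positivity)
  rw [mul_pow]
  exact hasSum_le (fun k => wt_mul_norm_coeff_mul_sq_le _ _ k) (norm_sq_eq (mul f g))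
    (hasSum_antidiagonal f g)

/-- Multiplication as a bounded bilinear map. -/
def mulL (m n : ℝ) [Fact (0 < m)] [Fact (0 < n)] : HL2 m →L[ℂ] HL2 n →L[ℂ] HL2 (m + n) :=
  LinearMap.mkContinuous₂ (LinearMap.mk₂ ℂ mul
    (fun f f' g => toHol_injective _ <| Hol.ext_eval fun z hz => by
      simp only [toHol_mul, map_add, Hol.eval_mul _ _ hz, Hol.eval_add _ _ hz, add_mul])
    (fun c f g => toHol_injective _ <| Hol.ext_eval fun z hz => by
      simp only [toHol_mul, map_smul, Hol.eval_mul _ _ hz, Hol.eval_smul _ _ hz, mul_assoc])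
    (fun f g g' => toHol_injective _ <| Hol.ext_eval fun z hz => by
      simp only [toHol_mul, map_add, Hol.eval_mul _ _ hz, Hol.eval_add _ _ hz, mul_add])
    (fun c f g => toHol_injective _ <| Hol.ext_eval fun z hz => by
      simp only [toHol_mul, map_smul, Hol.eval_mul _ _ hz, Hol.eval_smul _ _ hz, mul_left_comm]))
    1 fun f g => by simpa using norm_mul_le f g

@[simp]
theorem mulL_apply (f : HL2 m) (g : HL2 n) : mulL m n f g = mul f g := rfl

/-- The adjoint of the multiplication map: the operator `f ↦ (mul f)† F` attached to `F`. -/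
def mulAdjoint (m n : ℝ) [Fact (0 < m)] [Fact (0 < n)] :
    HL2 (m + n) →L[ℂ] (HL2 m →L⋆[ℂ] HL2 n) :=
  ContinuousLinearMap.flip
    (((ContinuousLinearMap.adjoint (𝕜 := ℂ) (E := HL2 n) (F := HL2 (m + n))
      ).toContinuousLinearEquiv : (HL2 n →L[ℂ] HL2 (m + n)) →L⋆[ℂ] _).comp (mulL m n))

theorem inner_mulAdjoint (F : HL2 (m + n)) (f : HL2 m) (g : HL2 n) :
    inner ℂ g (mulAdjoint m n F f) = inner ℂ (mul f g) F := by
  change inner ℂ g (ContinuousLinearMap.adjoint (mulL m n f) F) = _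
  rw [ContinuousLinearMap.adjoint_inner_right, mulL_apply]

theorem inner_antiAdjoint_mulAdjoint (F : HL2 (m + n)) (f : HL2 m) (g : HL2 n) :
    inner ℂ (antiAdjoint (mulAdjoint m n F) g) f = inner ℂ F (mul f g) := by
  rw [inner_antiAdjoint, ← inner_conj_symm, inner_mulAdjoint, inner_conj_symm]

theorem inner_monomialBasis (k : ℕ) (f : HL2 m) :
    inner ℂ (monomialBasis m k) f = √(wt m k) * (toHol m f).coeff k := by
  rw [← HilbertBasis.repr_apply_apply]
  rfl

theorem coeff_monomialBasis (i k : ℕ) :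
    (toHol m (monomialBasis m i)).coeff k = if k = i then (√(wt m i) : ℂ)⁻¹ else 0 := by
  have h := (inner_monomialBasis k (monomialBasis m i)).symm.trans
    (orthonormal_iff_ite.1 (monomialBasis m).orthonormal k i)
  rw [mul_comm, ← eq_div_iff (sqrt_wt_ne k)] at h
  rw [h]
  split_ifs with hki
  · rw [hki, one_div]
  · rw [zero_div]

theorem coeff_mul_monomialBasis (i j k : ℕ) :
    (toHol (m + n) (mul (monomialBasis m i) (monomialBasis n j))).coeff k =
      if k = i + j then (√(wt m i) : ℂ)⁻¹ * (√(wt n j) : ℂ)⁻¹ else 0 := by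
  rw [toHol_mul, Hol.coeff_mul]
  simp only [coeff_monomialBasis, mul_ite, ite_mul, zero_mul, mul_zero]
  rw [← Finset.sum_filter, ← Finset.sum_filter, Finset.filter_filter]
  split_ifs with h
  · rw [Finset.sum_eq_single_of_mem (i, j)]
    · simp [h]
    · rintro ⟨a, b⟩ hab hne
      simp only [Finset.mem_filter] at hab
      exact absurd (Prod.ext hab.2.2 hab.2.1) hne
  · refine Finset.sum_eq_zero fun p hp => absurd ?_ h
    simp only [Finset.mem_filter, mem_antidiagonal] at hp
    omega

/-- Up to the normalizing factors the matrix entry depends on `i + j` only: these are generalized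
Hankel operators. -/
theorem inner_mul_monomialBasis (F : HL2 (m + n)) (i j : ℕ) :
    inner ℂ F (mul (monomialBasis m i) (monomialBasis n j)) =
      wt (m + n) (i + j) * (conj ((toHol _ F).coeff (i + j)) *
        ((√(wt m i) : ℂ)⁻¹ * (√(wt n j) : ℂ)⁻¹)) := by
  rw [inner_eq, tsum_eq_single (i + j)]
  · simp only [coeff_mul_monomialBasis, if_true]
  · intro k hk
    simp only [coeff_mul_monomialBasis, if_neg hk, mul_zero]

theorem norm_inner_mul_monomialBasis_sq (F : HL2 (m + n)) (i j : ℕ) :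
    ‖inner ℂ F (mul (monomialBasis m i) (monomialBasis n j))‖ ^ 2 =
      wt (m + n) (i + j) * (wt (m + n) (i + j) * ‖(toHol _ F).coeff (i + j)‖ ^ 2) *
        ((wt m i)⁻¹ * (wt n j)⁻¹) := by
  have h1 := wt_pos (add_pos hm.out hn.out) (i + j)
  have h2 := wt_pos hm.out i
  have h3 := wt_pos hn.out j
  rw [inner_mul_monomialBasis]
  simp only [norm_mul, norm_inv, norm_real, RCLike.norm_conj, mul_pow, inv_pow,
    Real.norm_of_nonneg h1.le, Real.norm_of_nonneg (Real.sqrt_nonneg _), Real.sq_sqrt h2.le,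
    Real.sq_sqrt h3.le]
  ring

/-- Grouped by `k = i + j`, the squared entries of a full antidiagonal add up to the `k`-th term of
`‖F‖ ^ 2`, by the convolution identity. -/
theorem sum_norm_inner_mul_monomialBasis_sq_le (F : HL2 (m + n)) (s t : Finset ℕ) :
    ∑ j ∈ t, ∑ i ∈ s, ‖inner ℂ F (mul (monomialBasis m i) (monomialBasis n j))‖ ^ 2
      ≤ ‖F‖ ^ 2 := by
  rw [Finset.sum_comm, ← Finset.sum_product', ← Finset.sum_fiberwise_of_maps_to
    (t := (s ×ˢ t).image fun p => p.1 + p.2) fun p hp => Finset.mem_image_of_mem _ hp]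
  refine le_trans (Finset.sum_le_sum (g := fun k => wt (m + n) k * ‖(toHol _ F).coeff k‖ ^ 2)
    fun k _ => ?_) (sum_le_hasSum _ (fun k _ => ?_) (norm_sq_eq F))
  · have h := wt_pos (add_pos hm.out hn.out) k
    calc _ ≤ ∑ p ∈ antidiagonal k,
          ‖inner ℂ F (mul (monomialBasis m p.1) (monomialBasis n p.2))‖ ^ 2 := by
          refine Finset.sum_le_sum_of_subset_of_nonneg (fun p hp => ?_) fun _ _ _ => by positivity
          exact mem_antidiagonal.2 (Finset.mem_filter.1 hp).2
      _ = ∑ p ∈ antidiagonal k, wt (m + n) k * (wt (m + n) k * ‖(toHol _ F).coeff k‖ ^ 2) *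
            ((wt m p.1)⁻¹ * (wt n p.2)⁻¹) := by
          refine Finset.sum_congr rfl fun p hp => ?_
          rw [norm_inner_mul_monomialBasis_sq, mem_antidiagonal.1 hp]
      _ = _ := by
          rw [← Finset.mul_sum, sum_inv_wt_mul_inv_wt hm.out hn.out]
          field_simp
  · have h := wt_pos (add_pos hm.out hn.out) k
    positivity

theorem sum_norm_antiAdjoint_mulAdjoint_sq_le (F : HL2 (m + n)) (t : Finset ℕ) :
    ∑ j ∈ t, ‖antiAdjoint (mulAdjoint m n F) (monomialBasis n j)‖ ^ 2 ≤ ‖F‖ ^ 2 := by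
  have h := hasSum_sum (s := t) fun j _ => hasSum_norm_inner_sq (monomialBasis m)
    (antiAdjoint (mulAdjoint m n F) (monomialBasis n j))
  refine hasSum_le_of_sum_le h fun s => ?_
  rw [Finset.sum_comm]
  refine le_trans (le_of_eq ?_) (sum_norm_inner_mul_monomialBasis_sq_le F s t)
  refine Finset.sum_congr rfl fun j _ => Finset.sum_congr rfl fun i _ => ?_
  rw [norm_inner_symm, inner_antiAdjoint_mulAdjoint]

theorem isHilbertSchmidt_mulAdjoint (F : HL2 (m + n)) :
    IsHilbertSchmidt (mulAdjoint m n F) := by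
  refine ⟨‖F‖ ^ 2, fun N v hv => ?_⟩
  have h := hasSum_sum (s := Finset.univ) fun i _ => hasSum_norm_inner_sq (monomialBasis n)
    (mulAdjoint m n F (v i))
  refine hasSum_le_of_sum_le h fun t => ?_
  refine le_trans (Finset.sum_le_sum fun j _ => ?_) (sum_norm_antiAdjoint_mulAdjoint_sq_le F t)
  -- Bessel's inequality for the arbitrary orthonormal family `v`, after moving the operator onto
  -- the basis vector.
  refine le_trans (le_of_eq ?_) (hv.sum_inner_products_le (s := Finset.univ) _)
  refine Finset.sum_congr rfl fun i _ => ?_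
  rw [inner_mulAdjoint, norm_inner_symm, ← inner_antiAdjoint_mulAdjoint, norm_inner_symm]

theorem mulAdjoint_one (f : HL2 m) :
    mulAdjoint m n (one (m + n)) f = inner ℂ f (one m) • one n := by
  have key : ∀ {p : ℝ} [Fact (0 < p)] (h : HL2 p),
      inner ℂ h (one p) = conj ((toHol p h).coeff 0) := fun {p} hp h => by
    rw [inner_eq, tsum_eq_single 0]
    · simp [Hol.coeff_one, wt_zero hp.out]
    · intro k hk
      simp [Hol.coeff_one, hk]
  refine ext_inner_left ℂ fun g => ?_
  rw [inner_mulAdjoint, inner_smul_right, key, key, key, toHol_mul, Hol.coeff_mul]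
  simp

/-- The zeroth column of the Hankel matrix already contains every Taylor coefficient of `F`. -/
theorem mulAdjoint_injective : Function.Injective (mulAdjoint m n) := by
  rw [injective_iff_map_eq_zero]
  intro F hF
  refine (monomialBasis (m + n)).repr.injective ?_
  ext k
  have h : inner ℂ F (mul (monomialBasis m k) (monomialBasis n 0)) = 0 := by
    rw [← inner_conj_symm, ← inner_mulAdjoint, hF]
    simp
  rw [inner_mul_monomialBasis] at h
  have h0 : (wt (m + n) k : ℂ) ≠ 0 := by exact_mod_cast (wt_pos (add_pos hm.out hn.out) k).ne'
  have h1 := sqrt_wt_ne (m := m) k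
  have h2 := sqrt_wt_ne (m := n) 0
  simp only [add_zero, mul_eq_zero, h0, h1, h2, inv_eq_zero, or_false, false_or,
    map_eq_zero] at h
  rw [HilbertBasis.repr_apply_apply, inner_monomialBasis, h]
  simp

end HL2

/-! ### The group action, its cocycle, and unitarity. -/

/-- Since `exp (u - v) = 1`, the difference has zero derivative on a connected set. This settles
branches of logarithms: an identity is checked after exponentiation and at the origin. -/
theorem eqOn_disc_of_exp_eq {u v : ℂ → ℂ} (hu : DifferentiableOn ℂ u Disc)
    (hv : DifferentiableOn ℂ v Disc) (h : ∀ z ∈ Disc, exp (u z) = exp (v z)) (h0 : u 0 = v 0) :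
    Set.EqOn u v Disc := by
  have hd : DifferentiableOn ℂ (fun z => u z - v z) Disc := hu.sub hv
  have hderiv : Set.EqOn (deriv fun z => u z - v z) 0 Disc := fun z hz => by
    have hdz := (hd.differentiableAt (Metric.isOpen_ball.mem_nhds hz)).hasDerivAt
    have h1 : HasDerivAt (fun _ : ℂ => (1 : ℂ)) (exp (u z - v z) * deriv (fun z => u z - v z) z) z :=
      hdz.cexp.congr_of_eventuallyEq <| by
        filter_upwards [Metric.isOpen_ball.mem_nhds hz] with y hy
        rw [exp_sub, h y hy, div_self (exp_ne_zero _)]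
    have h2 := h1.unique (hasDerivAt_const z 1)
    simpa [exp_ne_zero] using h2
  intro z hz
  have := Metric.isOpen_ball.is_const_of_deriv_eq_zero (convex_ball (0 : ℂ) 1).isPreconnected
    hd hderiv hz (Metric.mem_ball_self one_pos)
  simp only [h0, sub_self] at this
  exact sub_eq_zero.1 this

namespace CoverG

/-- The inverse group element. -/
def inv (g : CoverG) : CoverG where
  a := conj g.a
  b := -g.b
  A := conj g.A
  det_eq := by simpa using g.det_eq
  exp_eq := by rw [exp_conj, g.exp_eq]

@[simp]
theorem inv_inv (g : CoverG) : g.inv.inv = g := by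
  cases g
  simp [inv]

/-- The logarithm of the denominator `a - conj b z` determined by the logarithm of `a`. -/
def logDen (g : CoverG) (z : ℂ) : ℂ := g.A + log (1 - conj g.b / g.a * z)

theorem exp_logDen (g : CoverG) {z : ℂ} (hz : z ∈ Disc) :
    exp (g.logDen z) = -conj g.b * z + g.a := by
  rw [logDen, exp_add, g.exp_eq, exp_log (slitPlane_ne_zero (g.mem_slitPlane hz))]
  field_simp [g.a_ne]
  ring

theorem differentiableOn_logDen (g : CoverG) : DifferentiableOn ℂ g.logDen Disc :=
  (DifferentiableOn.clog (by fun_prop) fun _ hz => g.mem_slitPlane hz).const_add _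

theorem differentiableOn_mobInv (g : CoverG) : DifferentiableOn ℂ g.mobInv Disc :=
  DifferentiableOn.div (by fun_prop) (by fun_prop) fun _ hz => g.den_ne hz

theorem eval_act (m : ℝ) (g : CoverG) (f : Hol) {z : ℂ} (hz : z ∈ Disc) :
    (g.act m f).eval z = exp (-2 * m * g.logDen z) * f.eval (g.mobInv z) := by
  rw [act, Hol.eval_mk _ _ hz, cpow_def_of_ne_zero (slitPlane_ne_zero (g.mem_slitPlane hz)),
    ← exp_add, logDen]
  ring_nf

theorem mul_conj_sub_mul_conj (g : CoverG) : g.a * conj g.a - g.b * conj g.b = 1 := by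
  rw [mul_conj, mul_conj, normSq_eq_norm_sq, normSq_eq_norm_sq]
  exact_mod_cast g.det_eq

theorem mobInv_mobInv_inv (g : CoverG) {z : ℂ} (hz : z ∈ Disc) :
    g.mobInv (g.inv.mobInv z) = z := by
  have h1 := g.inv.den_ne hz
  have hy := div_mul_cancel₀ (conj g.inv.a * z - g.inv.b) h1
  rw [← mobInv] at hy
  rw [mobInv, div_eq_iff (g.den_ne (g.inv.mobInv_mem hz))]
  apply mul_left_cancel₀ h1
  simp only [inv, map_neg, neg_neg, conj_conj] at hy ⊢
  linear_combination (conj g.a + z * conj g.b) * hy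

/-- The cocycle relation for `g⁻¹` followed by `g`, on the universal covering and not only up to
multiples of `2πi`. -/
theorem logDen_inv_add_logDen (g : CoverG) {z : ℂ} (hz : z ∈ Disc) :
    g.inv.logDen z + g.logDen (g.inv.mobInv z) = 0 := by
  refine eqOn_disc_of_exp_eq (u := fun z => g.inv.logDen z + g.logDen (g.inv.mobInv z))
    (v := fun _ => 0) (g.inv.differentiableOn_logDen.add
      (g.differentiableOn_logDen.comp g.inv.differentiableOn_mobInv fun z hz => g.inv.mobInv_mem hz))
    (differentiableOn_const 0) (fun z hz => ?_) ?_ hz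
  · have h := g.mul_conj_sub_mul_conj
    have h1 := g.inv.den_ne hz
    rw [exp_add, g.inv.exp_logDen hz, g.exp_logDen (g.inv.mobInv_mem hz), exp_zero]
    simp only [mobInv, inv, map_neg, neg_neg, conj_conj] at h1 ⊢
    field_simp
    linear_combination h
  · have h := g.mul_conj_sub_mul_conj
    have ha := g.a_ne
    have ha' : conj g.a ≠ 0 := by simpa using ha
    -- At the origin the argument of the logarithm is `|a|⁻²`, a positive real, so its principal
    -- logarithm is `-2 Re A` and cancels `A + conj A`.
    have e : 1 - conj g.b / g.a * (g.b / conj g.a) = ((Real.exp (-(2 * g.A.re)) : ℝ) : ℂ) := by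
      have e1 : g.a * conj g.a = ((Real.exp (2 * g.A.re) : ℝ) : ℂ) := by
        rw [mul_conj, normSq_eq_norm_sq, ← g.exp_eq, norm_exp, ← Real.exp_nat_mul]
        norm_num
      rw [Real.exp_neg, ofReal_inv, ← e1]
      field_simp
      linear_combination h
    simp only [logDen, mobInv, inv, map_neg, neg_neg, conj_conj, mul_zero, sub_zero, zero_add,
      log_one, add_zero, sub_neg_eq_add]
    rw [e, ← ofReal_log (Real.exp_pos _).le, Real.log_exp]
    apply Complex.ext <;> simp
    ring

/-- The logarithm of the transformation law of `1 - conj w z`. Multiplied by `-2m` and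
exponentiated, it shows that the group permutes the kernels up to scalars. -/
theorem log_kernel_mobInv (g : CoverG) {w z : ℂ} (hw : w ∈ Disc) (hz : z ∈ Disc) :
    log (1 - conj w * g.mobInv z) + g.logDen z =
      log (1 - conj (g.inv.mobInv w) * z) + conj (g.inv.logDen w) := by
  refine eqOn_disc_of_exp_eq (u := fun z => log (1 - conj w * g.mobInv z) + g.logDen z)
    (v := fun z => log (1 - conj (g.inv.mobInv w) * z) + conj (g.inv.logDen w))
    (DifferentiableOn.add (DifferentiableOn.clog
      ((g.differentiableOn_mobInv.const_mul _).const_sub _) fun z hz =>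
        Hol.one_sub_conj_mul_mem_slitPlane hw (g.mobInv_mem hz)) g.differentiableOn_logDen)
    (DifferentiableOn.add_const _ (DifferentiableOn.clog (by fun_prop) fun z hz =>
        Hol.one_sub_conj_mul_mem_slitPlane (g.inv.mobInv_mem hw) hz)) (fun z hz => ?_) ?_ hz
  · have hy := div_mul_cancel₀ (conj g.a * z - g.b) (g.den_ne hz)
    have hw' := congrArg conj (div_mul_cancel₀ (conj g.inv.a * w - g.inv.b) (g.inv.den_ne hw))
    rw [← mobInv] at hy hw'
    rw [exp_add, exp_add, exp_conj, g.inv.exp_logDen hw, g.exp_logDen hz,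
      exp_log (slitPlane_ne_zero (Hol.one_sub_conj_mul_mem_slitPlane hw (g.mobInv_mem hz))),
      exp_log (slitPlane_ne_zero (Hol.one_sub_conj_mul_mem_slitPlane (g.inv.mobInv_mem hw) hz))]
    rw [map_mul] at hw'
    simp only [inv, map_neg, neg_neg, conj_conj, map_add, map_mul, map_sub] at hw' ⊢
    linear_combination -conj w * hy + z * hw'
  · have h := g.inv.mem_slitPlane hw
    have e : 1 - conj w * g.mobInv 0 = conj (1 - conj g.inv.b / g.inv.a * w) := by
      simp [mobInv, inv]
      ring
    simp only [logDen, mul_zero, sub_zero, log_one, add_zero, zero_add, map_add]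
    rw [e, log_conj _ (slitPlane_arg_ne_pi h)]
    simp only [inv, conj_conj]
    ring

/-- The linear fractional transformation as a map of the disc. -/
def mob (g : CoverG) (w : Disc) : Disc := ⟨g.inv.mobInv w, g.inv.mobInv_mem w.2⟩

theorem act_kernel (m : ℝ) (g : CoverG) (w : Disc) :
    g.act m (Hol.kernel m w) =
      exp (-2 * m * conj (g.inv.logDen w)) • Hol.kernel m (g.mob w) := by
  refine Hol.ext_eval fun z hz => ?_
  have h := g.log_kernel_mobInv w.2 hz
  rw [eval_act m g _ hz, Hol.eval_smul _ _ hz, Hol.eval_kernel _ _ (g.mobInv_mem hz),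
    Hol.eval_kernel _ _ hz, mob,
    cpow_def_of_ne_zero (slitPlane_ne_zero (Hol.one_sub_conj_mul_mem_slitPlane w.2
      (g.mobInv_mem hz))),
    cpow_def_of_ne_zero (slitPlane_ne_zero (Hol.one_sub_conj_mul_mem_slitPlane
      (g.inv.mobInv_mem w.2) hz)), ← exp_add, ← exp_add]
  congr 1
  linear_combination (-2 * m : ℂ) * h

theorem act_act_inv (m : ℝ) (g : CoverG) (f : Hol) : g.act m (g.inv.act m f) = f := by
  refine Hol.ext_eval fun z hz => ?_
  have h := g.inv.logDen_inv_add_logDen hz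
  have h2 := g.inv.mobInv_mobInv_inv hz
  rw [inv_inv] at h h2
  rw [eval_act m g _ hz, eval_act m _ _ (g.mobInv_mem hz), h2, ← mul_assoc, ← exp_add, ← mul_add,
    h, mul_zero, exp_zero, one_mul]

theorem act_mul (m n : ℝ) (g : CoverG) (f h : Hol) :
    g.act (m + n) (Hol.mul f h) = Hol.mul (g.act m f) (g.act n h) := by
  refine Hol.ext_eval fun z hz => ?_
  rw [eval_act _ g _ hz, Hol.eval_mul _ _ (g.mobInv_mem hz), Hol.eval_mul _ _ hz, eval_act _ g _ hz,
    eval_act _ g _ hz, show (-2 * ((m + n : ℝ) : ℂ) * g.logDen z) =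
      -2 * m * g.logDen z + -2 * n * g.logDen z by push_cast; ring, exp_add]
  ring

end CoverG

namespace HL2

variable {m : ℝ} [hm : Fact (0 < m)]

theorem ext_kernel {G : Type*} [AddCommMonoid G] [Module ℂ G] [TopologicalSpace G] [T2Space G]
    {f g : HL2 m →L[ℂ] G} (h : ∀ w, f (kernel m w) = g (kernel m w)) : f = g := by
  have : f.toLinearMap ∘ₗ kernelSum m = g.toLinearMap ∘ₗ kernelSum m := by
    ext w
    simpa [kernelSum] using h w
  exact ContinuousLinearMap.coeFn_injective <|
    denseRange_kernelSum.equalizer f.continuous g.continuous (congrArg DFunLike.coe this)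

/-- The reproducing property turns the left side into a value of a transformed kernel at `g w`, and
the two automorphy factors cancel by the cocycle relation. Unitarity follows with no integral
formula for the norm. -/
theorem inner_kernel_act (g : CoverG) (w v : Disc) :
    inner ℂ (exp (-2 * m * conj (g.inv.logDen w)) • kernel m (g.mob w))
      (exp (-2 * m * conj (g.inv.logDen v)) • kernel m (g.mob v)) =
    inner ℂ (kernel m w) (kernel m v) := by
  rw [inner_smul_left, inner_kernel, inner_kernel, map_smul, toHol_kernel, toHol_kernel,
    ← CoverG.act_kernel, CoverG.eval_act _ _ _ (g.mob w).2, ← exp_conj, CoverG.mob,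
    g.mobInv_mobInv_inv w.2, ← mul_assoc, ← exp_add]
  have h := g.logDen_inv_add_logDen w.2
  simp only [map_mul, map_neg, conj_ofReal, map_ofNat, conj_conj]
  rw [← mul_add, h, mul_zero, exp_zero, one_mul]

/-- The images of the linear combinations of reproducing kernels under a group element. -/
def kernelSumAct (m : ℝ) [Fact (0 < m)] (g : CoverG) : (Disc →₀ ℂ) →ₗ[ℂ] HL2 m :=
  Finsupp.linearCombination ℂ
    fun w => exp (-2 * m * conj (g.inv.logDen w)) • kernel m (g.mob w)

theorem norm_kernelSumAct (g : CoverG) (x : Disc →₀ ℂ) :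
    ‖kernelSumAct m g x‖ = ‖kernelSum m x‖ := by
  rw [@norm_eq_sqrt_re_inner ℂ, @norm_eq_sqrt_re_inner ℂ, kernelSumAct, kernelSum,
    Finsupp.linearCombination_apply, Finsupp.linearCombination_apply, Finsupp.sum, Finsupp.sum]
  simp only [sum_inner, inner_sum]
  congr 2
  refine Finset.sum_congr rfl fun w _ => Finset.sum_congr rfl fun v _ => ?_
  rw [inner_smul_left, inner_smul_right, inner_kernel_act, inner_smul_left, inner_smul_right]

/-- The unitary action of a group element on `H^m ∩ L²`. -/
def actL (m : ℝ) [Fact (0 < m)] (g : CoverG) : HL2 m →L[ℂ] HL2 m :=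
  (kernelSumAct m g).extendOfNorm (kernelSum m)

theorem actL_kernel (g : CoverG) (w : Disc) :
    actL m g (kernel m w) = exp (-2 * m * conj (g.inv.logDen w)) • kernel m (g.mob w) := by
  have hn : ∃ C : ℝ, ∀ x, ‖kernelSumAct m g x‖ ≤ C * ‖kernelSum m x‖ :=
    ⟨1, fun x => by rw [one_mul, norm_kernelSumAct]⟩
  have hd : DenseRange (kernelSum m) := denseRange_kernelSum
  have := LinearMap.extendOfNorm_eq (f := kernelSumAct m g) (e := kernelSum m) hd hn
    (Finsupp.single w 1)
  have e1 : kernelSum m (Finsupp.single w 1) = kernel m w := by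
    rw [kernelSum, Finsupp.linearCombination_single, one_smul]
  have e2 : kernelSumAct m g (Finsupp.single w 1) =
      exp (-2 * m * conj (g.inv.logDen w)) • kernel m (g.mob w) := by
    rw [kernelSumAct, Finsupp.linearCombination_single, one_smul]
  rwa [e1, e2] at this

/-- Evaluation at `z` is continuous on the Hilbert space, so comparing the two sides on kernels
suffices. -/
theorem toHol_actL (g : CoverG) (f : HL2 m) : toHol m (actL m g f) = g.act m (toHol m f) := by
  refine Hol.ext_eval fun z hz => ?_
  have h : (innerSL ℂ (kernel m ⟨z, hz⟩)).comp (actL m g) =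
      exp (-2 * m * g.logDen z) • innerSL ℂ (kernel m ⟨g.mobInv z, g.mobInv_mem hz⟩) := by
    refine ext_kernel fun w => ?_
    simp only [ContinuousLinearMap.comp_apply, _root_.smul_apply, innerSL_apply_apply,
      inner_kernel, actL_kernel, map_smul, toHol_kernel, smul_eq_mul]
    rw [← Hol.eval_smul _ _ hz, ← CoverG.act_kernel, CoverG.eval_act _ _ _ hz]
  have h2 := congrArg (fun T : HL2 m →L[ℂ] ℂ => T f) h
  simp only [ContinuousLinearMap.comp_apply, _root_.smul_apply, innerSL_apply_apply,
    inner_kernel, smul_eq_mul] at h2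
  rw [h2, CoverG.eval_act _ _ _ hz]

theorem inner_actL (g : CoverG) (f h : HL2 m) :
    inner ℂ (actL m g f) (actL m g h) = inner ℂ f h := by
  have e : (ContinuousLinearMap.adjoint (actL m g)).comp (actL m g) =
      ContinuousLinearMap.id ℂ (HL2 m) := by
    refine ext_kernel fun w => ext_inner_kernel fun v => ?_
    rw [ContinuousLinearMap.comp_apply, ContinuousLinearMap.adjoint_inner_right, actL_kernel,
      actL_kernel, inner_kernel_act, ContinuousLinearMap.id_apply]
  rw [← ContinuousLinearMap.adjoint_inner_right, ← ContinuousLinearMap.comp_apply, e,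
    ContinuousLinearMap.id_apply]

theorem actL_actL_inv (g : CoverG) (f : HL2 m) : actL m g (actL m g.inv f) = f :=
  toHol_injective m <| by rw [toHol_actL, toHol_actL, CoverG.act_act_inv]

theorem one_eq_kernel : one m = kernel m ⟨0, Metric.mem_ball_self one_pos⟩ :=
  toHol_injective m <| Hol.ext_eval fun z hz => by
    rw [toHol_one, toHol_kernel, Hol.eval_kernel _ _ hz, Hol.one, Hol.eval_mk _ _ hz]
    simp

end HL2

theorem CoverG.exists_mob_eq (w : Disc) :
    ∃ g : CoverG, g.mob ⟨0, Metric.mem_ball_self one_pos⟩ = w := by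
  have hw : ‖(w : ℂ)‖ < 1 := mem_ball_zero_iff.1 w.2
  have hr : 0 < 1 - ‖(w : ℂ)‖ ^ 2 := by nlinarith [norm_nonneg (w : ℂ)]
  have hs : 0 < (√(1 - ‖(w : ℂ)‖ ^ 2))⁻¹ := inv_pos.2 (Real.sqrt_pos.2 hr)
  -- The origin goes to `b / conj a`; hence `b = w a` with `a` real and positive, normalized by the
  -- determinant condition.
  refine ⟨⟨((√(1 - ‖(w : ℂ)‖ ^ 2))⁻¹ : ℝ), w * ((√(1 - ‖(w : ℂ)‖ ^ 2))⁻¹ : ℝ),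
    (Real.log (√(1 - ‖(w : ℂ)‖ ^ 2))⁻¹ : ℝ), ?_, ?_⟩, ?_⟩
  · rw [norm_mul, norm_real, Real.norm_of_nonneg hs.le, mul_pow, inv_pow, Real.sq_sqrt hr.le]
    field_simp
  · rw [← ofReal_exp, Real.exp_log hs]
  · have : (((√(1 - ‖(w : ℂ)‖ ^ 2))⁻¹ : ℝ) : ℂ) ≠ 0 := by exact_mod_cast hs.ne'
    apply Subtype.ext
    simp only [CoverG.mob, CoverG.mobInv, CoverG.inv, conj_ofReal, mul_zero, zero_add,
      zero_sub, neg_neg]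
    exact mul_div_cancel_right₀ _ this

/-! ### Equivariance and uniqueness of the embedding. -/

namespace HL2

variable {m n : ℝ} [hm : Fact (0 < m)] [hn : Fact (0 < n)]

theorem mulAdjoint_actL (g : CoverG) (F : HL2 (m + n)) (f : HL2 m) :
    mulAdjoint m n (actL _ g F) (actL m g f) = actL n g (mulAdjoint m n F f) := by
  refine ext_inner_left ℂ fun h => ?_
  rw [← actL_actL_inv g h, inner_actL, inner_mulAdjoint, inner_mulAdjoint,
    ← inner_actL g (mul f _) F]
  congr 1
  refine toHol_injective _ ?_
  rw [toHol_actL, toHol_mul, toHol_mul, toHol_actL, toHol_actL, CoverG.act_mul]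

theorem isEquivariantEmbedding_mulAdjoint : IsEquivariantEmbedding m n (mulAdjoint m n) where
  hilbertSchmidt := isHilbertSchmidt_mulAdjoint
  injective := mulAdjoint_injective
  map_one := mulAdjoint_one
  equivariant g F F' f f' hF hf := by
    rw [← toHol_actL] at hF hf ⊢
    rw [toHol_injective _ hF, toHol_injective _ hf, mulAdjoint_actL]

/-- Equivariance and the normalization force `J (g 1) f = g (J 1 (g⁻¹ f))`, and the vectors `g 1`
are the kernels up to nonzero scalars. -/
theorem isEquivariantEmbedding_unique {J J' : HL2 (m + n) →L[ℂ] (HL2 m →L⋆[ℂ] HL2 n)}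
    (hJ : IsEquivariantEmbedding m n J) (hJ' : IsEquivariantEmbedding m n J') : J = J' := by
  refine ext_kernel fun w => ?_
  obtain ⟨g, rfl⟩ := CoverG.exists_mob_eq w
  have h : J (actL _ g (one _)) = J' (actL _ g (one _)) := by
    ext1 f
    refine toHol_injective _ ?_
    rw [hJ.equivariant g _ _ (actL m g.inv f) f (toHol_actL _ _)
        (by rw [← toHol_actL, actL_actL_inv]),
      hJ'.equivariant g _ _ (actL m g.inv f) f (toHol_actL _ _)
        (by rw [← toHol_actL, actL_actL_inv]), hJ.map_one, hJ'.map_one]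
  rw [one_eq_kernel, actL_kernel, map_smul, map_smul] at h
  exact smul_right_injective _ (exp_ne_zero _) h

theorem existsUnique_isEquivariantEmbedding : ∃! J, IsEquivariantEmbedding m n J :=
  ⟨mulAdjoint m n, isEquivariantEmbedding_mulAdjoint,
    fun _ hJ => isEquivariantEmbedding_unique hJ isEquivariantEmbedding_mulAdjoint⟩

theorem genHankel_eq_mulAdjoint : genHankel m n = mulAdjoint m n :=
  isEquivariantEmbedding_unique
    (Classical.epsilon_spec ⟨mulAdjoint m n, isEquivariantEmbedding_mulAdjoint⟩)
    isEquivariantEmbedding_mulAdjoint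

end HL2

/-! ### Finite determinants, Gaussian integrals and positive semidefinite matrices. -/

section Determinants

open Matrix
open scoped ComplexOrder

theorem det_one_add_eq_sum_minors {ι R : Type*} [Fintype ι] [DecidableEq ι] [CommRing R]
    (M : Matrix ι ι R) :
    (1 + M).det = ∑ s : Finset ι, (M.submatrix (Subtype.val : s → ι) Subtype.val).det := by
  -- The coefficient of `X^k` is the sum of the principal minors of size `k`; evaluation at `1` adds
  -- them all.
  set p : Polynomial R := (1 + (Polynomial.X : Polynomial R) • M.map Polynomial.C).det with hp
  have hc : ∀ k, p.coeff k = _ := fun k => coeff_det_one_add_X_smul_eq_sum_minors M k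
  have hdeg : p.natDegree < Fintype.card ι + 1 := by
    refine Nat.lt_succ_of_le (Polynomial.natDegree_le_iff_coeff_eq_zero.2 fun k hk => ?_)
    rw [hc, Finset.powersetCard_eq_empty.2 (by simpa using hk), Finset.sum_empty]
  have h1 : p.eval 1 = (1 + M).det := by
    rw [hp, ← Polynomial.coe_evalRingHom, RingHom.map_det]
    congr 1
    ext i j
    simp [Matrix.one_apply, apply_ite]
  rw [← h1, Polynomial.eval_eq_sum_range' hdeg, ← Finset.powerset_univ, Finset.sum_powerset]
  simp [hc, Finset.card_univ]

theorem det_one_add_submatrix_eq_sum_minors {ι R : Type*} [DecidableEq ι] [CommRing R]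
    (M : Matrix ι ι R) (s : Finset ι) :
    (1 + M.submatrix (Subtype.val : s → ι) Subtype.val).det =
      ∑ t ∈ s.powerset, (M.submatrix (Subtype.val : t → ι) Subtype.val).det := by
  rw [det_one_add_eq_sum_minors]
  refine Finset.sum_bij (fun u _ => u.map (Function.Embedding.subtype (· ∈ s))) (fun u _ => ?_)
    (fun u _ v _ h => Finset.map_injective _ h) (fun t ht => ?_) fun u _ => ?_
  · exact Finset.mem_powerset.2 (Finset.map_subtype_subset u)
  · exact ⟨t.subtype (· ∈ s), Finset.mem_univ _,
      Finset.subtype_map_of_mem fun x hx => Finset.mem_powerset.1 ht hx⟩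
  · let e : u ≃ (u.map (Function.Embedding.subtype (· ∈ s)) : Finset ι) :=
      Equiv.ofBijective (fun x => ⟨x.1.1, Finset.mem_map_of_mem _ x.2⟩)
        ⟨fun x y h => Subtype.ext (Subtype.ext (Subtype.mk.inj h)), fun y => by
          obtain ⟨x, hx, hxy⟩ := Finset.mem_map.1 y.2
          exact ⟨⟨x, hx⟩, Subtype.ext hxy⟩⟩
    rw [← det_submatrix_equiv_self e]
    rfl

/-- Apply `t ≤ exp (t - 1)` to each eigenvalue `t` of `1 + A`. -/
theorem det_one_add_le_exp_trace {ι : Type*} [Fintype ι] [DecidableEq ι] {A : Matrix ι ι ℂ}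
    (hA : A.PosSemidef) : ‖(1 + A).det‖ ≤ Real.exp (A.trace).re := by
  have hH : (1 + A).PosDef := PosDef.one.add_posSemidef hA
  have h1 := hH.isHermitian.det_eq_prod_eigenvalues
  have h2 := hH.isHermitian.trace_eq_sum_eigenvalues
  have h3 : A.trace.re = ∑ i, (hH.isHermitian.eigenvalues i - 1) := by
    rw [trace_add, trace_one] at h2
    have := congrArg re h2
    simp only [add_re, natCast_re, re_sum, coe_algebraMap, ofReal_re] at this
    rw [Finset.sum_sub_distrib]
    simp at this ⊢
    linarith
  rw [h1, h3, norm_prod, Real.exp_sum]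
  refine Finset.prod_le_prod (fun i _ => norm_nonneg _) fun i _ => ?_
  have := Real.add_one_le_exp (hH.isHermitian.eigenvalues i - 1)
  simp only [sub_add_cancel] at this
  simpa [abs_of_pos (hH.eigenvalues_pos i)] using this

/-- A unitary change of variables diagonalizes `H` and preserves Lebesgue measure, because its real
determinant is `|det U|² = 1`. Each remaining planar integral equals `π / λ`. -/
theorem integral_exp_neg_dotProduct_mulVec {ι : Type*} [Fintype ι] [DecidableEq ι]
    {H : Matrix ι ι ℂ} (hH : H.PosDef) :
    ∫ x : ι → ℂ, exp (-(star x ⬝ᵥ H *ᵥ x)) = Real.pi ^ Fintype.card ι / H.det := by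
  set U : Matrix ι ι ℂ := hH.isHermitian.eigenvectorUnitary.1 with hU
  have hUU : star U * U = 1 := Unitary.coe_star_mul_self _
  have hdiag : star U * H * U = diagonal fun i => (hH.isHermitian.eigenvalues i : ℂ) := by
    have := hH.isHermitian.conjStarAlgAut_star_eigenvectorUnitary
    rw [Unitary.conjStarAlgAut_apply] at this
    simpa [hU] using! this
  set f : (ι → ℂ) →ₗ[ℝ] (ι → ℂ) := (toLin' U).restrictScalars ℝ with hf
  have hnorm : normSq U.det = 1 := by
    have := congrArg det hUU
    rw [det_mul, det_one, star_eq_conjTranspose, det_conjTranspose] at this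
    rw [← ofReal_inj, ← mul_conj, mul_comm]
    simpa using this
  have hdet : LinearMap.det f = 1 := by
    rw [hf, LinearMap.det_restrictScalars, LinearMap.det_toLin', Algebra.norm_complex_eq]
    exact hnorm
  have hmap : Measure.map f volume = (volume : Measure (ι → ℂ)) := by
    rw [Measure.map_linearMap_addHaar_eq_smul_addHaar _ (by rw [hdet]; exact one_ne_zero), hdet]
    simp
  have hcont : Continuous fun x : ι → ℂ => exp (-(star x ⬝ᵥ H *ᵥ x)) := by
    unfold dotProduct mulVec dotProduct
    fun_prop
  have hfc : Continuous f := f.continuous_of_finiteDimensional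
  rw [← hmap, integral_map hfc.aemeasurable hcont.aestronglyMeasurable]
  have e : ∀ y : ι → ℂ, exp (-(star (f y) ⬝ᵥ H *ᵥ f y)) =
      ∏ i, exp (-(hH.isHermitian.eigenvalues i : ℂ) * ‖y i‖ ^ 2) := fun y => by
    have : f y = U *ᵥ y := rfl
    rw [this, star_mulVec, ← dotProduct_mulVec, mulVec_mulVec, mulVec_mulVec,
      ← star_eq_conjTranspose, hdiag, ← exp_sum]
    congr 1
    simp only [dotProduct, mulVec_diagonal]
    rw [ ← Finset.sum_neg_distrib]
    refine Finset.sum_congr rfl fun i _ => ?_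
    rw [← conj_mul']
    simp
    ring
  simp only [e]
  rw [integral_fintype_prod_volume_eq_prod (fun i (z : ℂ) =>
    exp (-(hH.isHermitian.eigenvalues i : ℂ) * ‖z‖ ^ 2)), hH.isHermitian.det_eq_prod_eigenvalues]
  simp_rw [GaussianFourier.integral_cexp_neg_mul_sq_norm
    (show 0 < re ((hH.isHermitian.eigenvalues _ : ℝ) : ℂ) from hH.eigenvalues_pos _)]
  simp [finrank_real_complex, Finset.prod_div_distrib, Finset.card_univ]

theorem posSemidef_of_tendsto {ι α : Type*} {l : Filter α} [l.NeBot] [Fintype ι]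
    {M : α → Matrix ι ι ℂ} {A : Matrix ι ι ℂ} (hM : ∀ a, (M a).PosSemidef)
    (h : ∀ i j, Filter.Tendsto (fun a => M a i j) l (nhds (A i j))) : A.PosSemidef := by
  refine PosSemidef.of_dotProduct_mulVec_nonneg ?_ fun x => ?_
  · ext i j
    refine tendsto_nhds_unique ?_ (h i j)
    refine ((h j i).star).congr fun a => ?_
    exact (hM a).isHermitian.apply i j
  · refine ge_of_tendsto' (x := l) (a := star x ⬝ᵥ A *ᵥ x)
      (f := fun a => star x ⬝ᵥ M a *ᵥ x) ?_ fun a => (hM a).dotProduct_mulVec_nonneg x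
    unfold dotProduct mulVec dotProduct
    exact tendsto_finsetSum _ fun i _ => tendsto_const_nhds.mul
      (tendsto_finsetSum _ fun j _ => (h i j).mul tendsto_const_nhds)

theorem posSemidef_pow {ι : Type*} [Finite ι] {A : Matrix ι ι ℂ} (hA : A.PosSemidef) (k : ℕ) :
    (of fun i j => A i j ^ k).PosSemidef := by
  induction k with
  | zero =>
    convert! posSemidef_vecMulVec_self_star (fun _ : ι => (1 : ℂ)) using 1
    ext i j
    simp [vecMulVec]
  | succ k ih =>
    convert! ih.hadamard hA using 1

theorem posSemidef_exp {ι : Type*} [Fintype ι] {A : Matrix ι ι ℂ} (hA : A.PosSemidef) :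
    (of fun i j => exp (A i j)).PosSemidef := by
  refine posSemidef_of_tendsto (l := Filter.atTop)
    (M := fun L : ℕ => ∑ k ∈ Finset.range L, ((k ! : ℝ)⁻¹ : ℂ) • of fun i j => A i j ^ k)
    (fun L => posSemidef_sum _ fun k _ => (posSemidef_pow hA k).smul ?_) fun i j => ?_
  · rw [← ofReal_inv]
    exact_mod_cast (by positivity : (0 : ℝ) ≤ (k ! : ℝ)⁻¹)
  · have := (NormedSpace.expSeries_hasSum_exp (𝕂 := ℂ) (A i j)).tendsto_sum_nat
    simp only [of_apply, exp_eq_exp_ℂ]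
    refine this.congr fun L => ?_
    rw [Matrix.sum_apply]
    refine Finset.sum_congr rfl fun k _ => ?_
    rw [NormedSpace.expSeries_apply_eq]
    simp

/-- Schoenberg's factorization `exp(-‖x‖²) exp(2 Re ⟪x, y⟫) exp(-‖y‖²)`: a rank one matrix times,
entrywise, the exponential of a positive semidefinite matrix. -/
theorem posSemidef_gaussian {ι E : Type*} [Fintype ι] [NormedAddCommGroup E]
    [InnerProductSpace ℂ E] (x : ι → E) :
    (of fun i j => exp (-(‖x i - x j‖ ^ 2 : ℝ))).PosSemidef := by
  have hG : (gram ℂ x + (gram ℂ x)ᵀ).PosSemidef :=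
    (posSemidef_gram ℂ x).add (posSemidef_gram ℂ x).transpose
  have hD := posSemidef_vecMulVec_self_star fun i : ι => exp (-(‖x i‖ ^ 2 : ℝ))
  convert! (posSemidef_exp hG).hadamard hD using 1
  ext i j
  simp only [of_apply, hadamard_apply, vecMulVec_apply, Matrix.add_apply, transpose_apply, gram_apply,
    Pi.star_apply, ← exp_add, star_def, ← Complex.exp_conj, map_neg, conj_ofReal]
  congr 1
  have h1 : inner ℂ (x i) (x j) + inner ℂ (x j) (x i) = ((2 * re (inner ℂ (x i) (x j)) : ℝ) : ℂ) := by
    rw [← inner_conj_symm (x j) (x i), add_conj]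
  rw [h1, @norm_sub_sq ℂ]
  push_cast
  simp
  ring

end Determinants

/-! ### Positive definiteness of inverse Fredholm determinants. -/

section Fredholm

open Matrix
open scoped ComplexOrder

theorem posSemidef_integral {ι X : Type*} [Fintype ι] [MeasurableSpace X] {μ : Measure X}
    {M : X → Matrix ι ι ℂ} (hM : ∀ x, (M x).PosSemidef)
    (hi : ∀ i j, Integrable (fun x => M x i j) μ) :
    (of fun i j => ∫ x, M x i j ∂μ).PosSemidef := by
  refine PosSemidef.of_dotProduct_mulVec_nonneg ?_ fun v => ?_
  · ext i j
    simp only [conjTranspose_apply, of_apply]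
    rw [star_def, ← integral_conj]
    congr 1
    funext x
    exact (hM x).isHermitian.apply i j
  · have h : star v ⬝ᵥ (of fun i j => ∫ x, M x i j ∂μ) *ᵥ v = ∫ x, star v ⬝ᵥ M x *ᵥ v ∂μ := by
      simp only [dotProduct, mulVec, of_apply]
      rw [integral_finsetSum _ fun i _ => (integrable_finsetSum _ fun j _ =>
        (hi i j).mul_const _).const_mul _]
      refine Finset.sum_congr rfl fun i _ => ?_
      rw [integral_const_mul, integral_finsetSum _ fun j _ => (hi i j).mul_const _]
      simp_rw [integral_mul_const]
    have h2 : ∀ x, star v ⬝ᵥ M x *ᵥ v = ((re (star v ⬝ᵥ M x *ᵥ v) : ℝ) : ℂ) := fun x =>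
      eq_re_of_ofReal_le ((hM x).dotProduct_mulVec_nonneg v)
    rw [h, integral_congr_ae (Filter.Eventually.of_forall h2), integral_complex_ofReal]
    exact_mod_cast integral_nonneg fun x => (le_def.1 ((hM x).dotProduct_mulVec_nonneg v)).1

variable {E : Type*} [NormedAddCommGroup E] [InnerProductSpace ℂ E]

/-- The transpose and the conjugated coefficients appear together because `antiAdjoint` is conjugate
linear. -/
theorem star_dotProduct_gram_transpose_mulVec {ι : Type*} [Fintype ι] (c : ι → E) (x : ι → ℂ) :
    star x ⬝ᵥ (gram ℂ c)ᵀ *ᵥ x = (‖∑ i, conj (x i) • c i‖ ^ 2 : ℝ) := by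
  have h := inner_self_eq_norm_sq_to_K (𝕜 := ℂ) (∑ i, conj (x i) • c i)
  rw [ofReal_pow]
  refine Eq.trans ?_ h
  simp only [sum_inner, inner_sum, inner_smul_left, inner_smul_right, dotProduct, mulVec,
    transpose_apply, gram_apply, Pi.star_apply, Finset.mul_sum, conj_conj, star_def]
  refine Finset.sum_congr rfl fun i _ => Finset.sum_congr rfl fun j _ => ?_
  ring

/-- The heart of (a): the inverse determinant is a mixture over `x`, with weight `exp(-|x|²)`, of
Gaussian kernels in the vectors `∑ conj x_k c(F)_k`. Additivity of `c` makes these kernels functions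
of differences. -/
theorem posSemidef_det_one_add_gram_inv {ι V : Type*} [Fintype ι] [DecidableEq ι] [AddCommGroup V]
    (c : V →+ ι → E) {N : ℕ} (F : Fin N → V) :
    (of fun i j => ((1 + (gram ℂ (c (F i - F j)))ᵀ).det)⁻¹).PosSemidef := by
  have hpos : ∀ G : V, (1 + (gram ℂ (c G))ᵀ).PosDef := fun G =>
    PosDef.one.add_posSemidef (posSemidef_gram ℂ (c G)).transpose
  have hpi : (Real.pi : ℂ) ^ Fintype.card ι ≠ 0 :=
    pow_ne_zero _ (by exact_mod_cast Real.pi_ne_zero)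
  have hint := fun G => integral_exp_neg_dotProduct_mulVec (hpos G)
  have hI : (of fun i j => ∫ x : ι → ℂ,
      exp (-(star x ⬝ᵥ (1 + (gram ℂ (c (F i - F j)))ᵀ) *ᵥ x))).PosSemidef := by
    refine posSemidef_integral (M := fun x => of fun i j =>
      exp (-(star x ⬝ᵥ (1 + (gram ℂ (c (F i - F j)))ᵀ) *ᵥ x))) (fun x => ?_) fun i j => ?_
    · have h0 : (0 : ℂ) ≤ exp (-(star x ⬝ᵥ x)) := by
        have : star x ⬝ᵥ x = ((∑ i, ‖x i‖ ^ 2 : ℝ) : ℂ) := by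
          simp only [dotProduct, ofReal_sum]
          refine Finset.sum_congr rfl fun i _ => ?_
          rw [ofReal_pow, ← conj_mul']
          rfl
        rw [this, ← ofReal_neg, ← ofReal_exp]
        exact_mod_cast (Real.exp_pos _).le
      convert! (posSemidef_gaussian fun i => ∑ k, conj (x k) • c (F i) k).smul h0 using 1
      ext i j
      rw [Matrix.smul_apply, of_apply, of_apply, add_mulVec, one_mulVec, dotProduct_add,
        star_dotProduct_gram_transpose_mulVec, neg_add, Complex.exp_add, smul_eq_mul,
        ← Finset.sum_sub_distrib]
      simp only [map_sub, Pi.sub_apply, smul_sub]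
    -- A nonintegrable function has integral `0` by convention, whereas this integral is known to be
    -- nonzero.
    · refine not_imp_comm.1 integral_undef ?_
      simp only [of_apply]
      rw [hint]
      exact div_ne_zero hpi (hpos _).det_pos.ne'
  simp only [hint] at hI
  have h1 : (0 : ℂ) ≤ (((Real.pi ^ Fintype.card ι)⁻¹ : ℝ) : ℂ) := by
    exact_mod_cast (by positivity : (0 : ℝ) ≤ (Real.pi ^ Fintype.card ι)⁻¹)
  convert! hI.smul h1 using 1
  ext i j
  rw [Matrix.smul_apply, of_apply, of_apply, smul_eq_mul, ofReal_inv, ofReal_pow]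
  field_simp

variable {F : Type*} [NormedAddCommGroup F] [InnerProductSpace ℂ F] [CompleteSpace E]
  {ι : Type*} [DecidableEq ι] (b : HilbertBasis ι ℂ F)

theorem antiAdjoint_sub (C D : E →L⋆[ℂ] F) (g : F) :
    antiAdjoint (C - D) g = antiAdjoint C g - antiAdjoint D g := by
  refine ext_inner_right ℂ fun f => ?_
  rw [inner_antiAdjoint, inner_sub_left, inner_antiAdjoint, inner_antiAdjoint, ← inner_sub_left]
  rfl

theorem sum_principalMinor_mulStar (C : E →L⋆[ℂ] F) (s : Finset ι) :
    ∑ t ∈ s.powerset, principalMinor b (mulStar C) t =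
      (1 + (gram ℂ fun i : s => antiAdjoint C (b i))ᵀ).det := by
  have h := det_one_add_submatrix_eq_sum_minors
    (of fun i j => inner ℂ (b i) (mulStar C (b j))) s
  refine h.symm.trans ?_
  congr 2
  ext i j
  exact inner_mulStar C (b i) (b j)

theorem principalMinor_mulStar_nonneg (C : E →L⋆[ℂ] F) (s : Finset ι) :
    0 ≤ principalMinor b (mulStar C) s := by
  have h := (posSemidef_gram ℂ fun i : s => antiAdjoint C (b i)).transpose.det_nonneg
  refine h.trans_eq (congrArg det ?_)
  ext i j
  exact (inner_mulStar C (b i) (b j)).symm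

/-- The minors are nonnegative, so bounded partial sums suffice, and the sum over all subsets of a
finite set is a determinant bounded by the exponential of its trace. -/
theorem summable_principalMinor_mulStar {C : E →L⋆[ℂ] F} {K : ℝ}
    (hK : ∀ s : Finset ι, ∑ i ∈ s, ‖antiAdjoint C (b i)‖ ^ 2 ≤ K) :
    Summable (principalMinor b (mulStar C)) := by
  refine Summable.of_norm (summable_of_sum_le (c := Real.exp K) (fun _ => norm_nonneg _) fun u => ?_)
  have hn : ∀ t, principalMinor b (mulStar C) t = (‖principalMinor b (mulStar C) t‖ : ℂ) :=
    fun t => eq_coe_norm_of_nonneg (principalMinor_mulStar_nonneg b C t)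
  -- Enlarge the finite family `u` to the power set of its union.
  calc ∑ t ∈ u, ‖principalMinor b (mulStar C) t‖
      ≤ ∑ t ∈ (u.sup id).powerset, ‖principalMinor b (mulStar C) t‖ :=
        Finset.sum_le_sum_of_subset_of_nonneg
          (fun t ht => Finset.mem_powerset.2 (Finset.le_sup (f := id) ht))
          fun _ _ _ => norm_nonneg _
    _ = ‖∑ t ∈ (u.sup id).powerset, principalMinor b (mulStar C) t‖ := by
        rw [Finset.sum_congr rfl fun t _ => hn t, ← ofReal_sum, norm_real,
          Real.norm_of_nonneg (Finset.sum_nonneg fun _ _ => norm_nonneg _)]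
    _ ≤ Real.exp K := by
        rw [sum_principalMinor_mulStar]
        refine (det_one_add_le_exp_trace (posSemidef_gram ℂ _).transpose).trans
          (Real.exp_le_exp.2 ((le_of_eq ?_).trans (hK (u.sup id))))
        rw [trace_transpose, trace, re_sum,
          ← Finset.sum_coe_sort (u.sup id) fun i => ‖antiAdjoint C (b i)‖ ^ 2]
        refine Finset.sum_congr rfl fun i _ => ?_
        exact inner_self_eq_norm_sq (𝕜 := ℂ) _

theorem tendsto_det_one_add_gram {C : E →L⋆[ℂ] F} {K : ℝ}
    (hK : ∀ s : Finset ι, ∑ i ∈ s, ‖antiAdjoint C (b i)‖ ^ 2 ≤ K) :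
    Filter.Tendsto (fun s : Finset ι => (1 + (gram ℂ fun i : s => antiAdjoint C (b i))ᵀ).det)
      Filter.atTop (nhds (detOneAdd b (mulStar C))) := by
  have h := (summable_principalMinor_mulStar b hK).hasSum
  -- Power sets of finite sets are cofinal among finite families, so the finite sections compute the
  -- full sum.
  have hp : Filter.Tendsto (Finset.powerset : Finset ι → Finset (Finset ι))
      Filter.atTop Filter.atTop :=
    Filter.tendsto_atTop_finset_of_monotone (fun s t hst => Finset.powerset_mono.2 hst)
      fun s => ⟨s, Finset.mem_powerset_self s⟩
  exact (Filter.Tendsto.comp h hp).congr fun s => sum_principalMinor_mulStar b C s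

theorem detOneAdd_mulStar_ne_zero {C : E →L⋆[ℂ] F} {K : ℝ}
    (hK : ∀ s : Finset ι, ∑ i ∈ s, ‖antiAdjoint C (b i)‖ ^ 2 ≤ K) :
    detOneAdd b (mulStar C) ≠ 0 := by
  -- The empty minor contributes `1` and the others are nonnegative.
  have h : 1 ≤ detOneAdd b (mulStar C) := by
    refine ge_of_tendsto' (tendsto_det_one_add_gram b hK) fun s => ?_
    rw [← sum_principalMinor_mulStar]
    have := Finset.single_le_sum (f := principalMinor b (mulStar C))
      (fun t _ => principalMinor_mulStar_nonneg b C t) (Finset.empty_mem_powerset s)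
    simpa [principalMinor] using this
  exact (zero_lt_one.trans_le h).ne'

theorem isPositiveDefinite_detOneAdd_pow_inv {V : Type*} [AddCommGroup V]
    (C : V →+ (E →L⋆[ℂ] F))
    (hC : ∀ v, ∃ K : ℝ, ∀ s : Finset ι, ∑ i ∈ s, ‖antiAdjoint (C v) (b i)‖ ^ 2 ≤ K) (j : ℕ) :
    IsPositiveDefinite fun v => (detOneAdd b (mulStar (C v)) ^ j)⁻¹ := by
  intro N x
  have h : (of fun i k => (detOneAdd b (mulStar (C (x i - x k))))⁻¹).PosSemidef := by
    refine posSemidef_of_tendsto (l := Filter.atTop) (M := fun s : Finset ι => of fun i k =>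
      ((1 + (gram ℂ fun r : s => antiAdjoint (C (x i - x k)) (b r))ᵀ).det)⁻¹)
      (fun s => ?_) fun i k => ?_
    · exact posSemidef_det_one_add_gram_inv
        (AddMonoidHom.ofMapSub (fun v (r : s) => antiAdjoint (C v) (b r)) fun v w => by
          funext r
          simp only [map_sub, antiAdjoint_sub, Pi.sub_apply]) x
    · obtain ⟨K, hK⟩ := hC (x i - x k)
      exact (tendsto_det_one_add_gram b hK).inv₀ (detOneAdd_mulStar_ne_zero b hK)
  convert! posSemidef_pow h j using 1
  ext i k
  simp only [of_apply, inv_pow]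

end Fredholm

namespace HL2

variable {m n : ℝ} [hm : Fact (0 < m)] [hn : Fact (0 < n)]

theorem summable_principalMinor_genHankel (F : HL2 (m + n)) :
    Summable fun s : Finset ℕ =>
      principalMinor (monomialBasis n) (mulStar (genHankel m n F)) s := by
  rw [genHankel_eq_mulAdjoint]
  exact summable_principalMinor_mulStar _ (sum_norm_antiAdjoint_mulAdjoint_sq_le F)

theorem isPositiveDefinite_detB_pow_inv (j : ℕ) :
    IsPositiveDefinite fun F : HL2 (m + n) => (detB m n F ^ j)⁻¹ := by
  simp only [detB, genHankel_eq_mulAdjoint]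
  exact isPositiveDefinite_detOneAdd_pow_inv (monomialBasis n)
    (mulAdjoint m n : HL2 (m + n) →+ (HL2 m →L⋆[ℂ] HL2 n))
    (fun F => ⟨‖F‖ ^ 2, sum_norm_antiAdjoint_mulAdjoint_sq_le F⟩) j

end HL2

/-! ### Topology of the space of holomorphic functions and measurability. -/

namespace Hol

instance : LocallyCompactSpace Disc := Metric.isOpen_ball.locallyCompactSpace

/-- Second countability makes the product σ-algebra on `Hol × Hol` the Borel one, so that the
continuous multiplication map is measurable. -/
instance : SecondCountableTopology Hol :=
  Topology.IsInducing.subtypeVal.secondCountableTopology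

instance : TopologicalSpace.PseudoMetrizableSpace C(Disc, ℂ) :=
  UniformSpace.pseudoMetrizableSpace

instance : TopologicalSpace.PseudoMetrizableSpace Hol :=
  Topology.IsInducing.subtypeVal.pseudoMetrizableSpace

theorem eval_coe (f : Hol) (z : Disc) : eval f z = f.1 z := extZero_of_mem _ z.2

theorem continuous_mul : Continuous fun p : Hol × Hol => mul p.1 p.2 := by
  refine Topology.IsInducing.subtypeVal.continuous_iff.2 ?_
  have h : Continuous fun p : Hol × Hol => p.1.1 * p.2.1 := by fun_prop
  refine h.congr fun p => ContinuousMap.ext fun z => ?_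
  change p.1.1 z * p.2.1 z = (mul p.1 p.2).1 z
  rw [← eval_coe, ← eval_coe, ← eval_coe, eval_mul _ _ z.2]

instance : ContinuousAdd Hol := ⟨Topology.IsInducing.subtypeVal.continuous_iff.2 <| by
  have h : Continuous fun p : Hol × Hol => p.1.1 + p.2.1 := by fun_prop
  exact h⟩

instance : ContinuousSMul ℂ Hol := ⟨Topology.IsInducing.subtypeVal.continuous_iff.2 <| by
  have h : Continuous fun p : ℂ × Hol => p.1 • p.2.1 := by fun_prop
  exact h⟩

theorem tendsto_iff {α : Type*} {l : Filter α} {f : α → Hol} {g : Hol} :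
    Filter.Tendsto f l (nhds g) ↔ ∀ K : Set Disc, IsCompact K →
      TendstoUniformlyOn (fun a (z : Disc) => (f a).1 z) g.1 l K := by
  rw [tendsto_subtype_rng, ContinuousMap.tendsto_iff_forall_isCompact_tendstoUniformlyOn]

/-- The `k`-th Taylor coefficient as a linear map. -/
def coeffₗ (k : ℕ) : Hol →ₗ[ℂ] ℂ where
  toFun f := coeff f k
  map_add' f g := coeff_add f g k
  map_smul' c f := coeff_smul c f k

theorem continuous_coeff (k : ℕ) : Continuous fun f : Hol => coeff f k := by
  refine continuous_of_continuousAt_zero (coeffₗ k) ?_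
  rw [ContinuousAt, map_zero, Metric.tendsto_nhds]
  intro ε hε
  set K : Set Disc := (Subtype.val : Disc → ℂ) ⁻¹' Metric.sphere 0 (1 / 2) with hKdef
  have hKc : IsCompact K := by
    rw [Topology.IsEmbedding.subtypeVal.isCompact_iff, Subtype.image_preimage_coe,
      Set.inter_eq_right.2]
    · exact isCompact_sphere _ _
    · exact Metric.sphere_subset_ball (by norm_num)
  have h0 := tendsto_iff.1 (Filter.tendsto_id (x := nhds (0 : Hol))) K hKc
  -- With this bound on the circle of radius `1 / 2`, Cauchy's estimate gives `ε / 2` for the `k`-th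
  -- coefficient.
  have hpos : (0 : ℝ) < ε * (1 / 2) ^ k / 2 := by positivity
  filter_upwards [Metric.tendstoUniformlyOn_iff.1 h0 _ hpos] with f hf
  have hle := Complex.norm_iteratedDeriv_le_of_forall_mem_sphere_norm_le (c := 0) (R := 1 / 2) k
    (f := eval f) (C := ε * (1 / 2) ^ k / 2) (by norm_num)
    ((f.differentiableOn_eval.mono (by
      rw [closure_ball _ (by norm_num)]
      exact Metric.closedBall_subset_ball (by norm_num))).diffContOnCl)
    fun z hz => by
      have hz1 : z ∈ Disc := Metric.sphere_subset_ball (by norm_num) hz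
      have := hf ⟨z, hz1⟩ hz
      rw [eval_coe f ⟨z, hz1⟩]
      simpa using this.le
  change dist (coeff f k) 0 < ε
  rw [dist_zero_right, coeff, norm_mul, norm_inv, norm_natCast]
  have hk : (0 : ℝ) < k ! := by positivity
  calc (k ! : ℝ)⁻¹ * ‖iteratedDeriv k (eval f) 0‖
      ≤ (k ! : ℝ)⁻¹ * (k ! * (ε * (1 / 2) ^ k / 2) / (1 / 2) ^ k) := by gcongr
    _ = ε / 2 := by field_simp
    _ < ε := by linarith

/-- The monomial `z^k`. -/
def monomial (k : ℕ) : Hol := mk (fun z => z ^ k) (by fun_prop)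

/-- The Weierstrass test: a compact set lies in some disc `|z| ≤ r < 1`, where the terms are
dominated by those at `r`. -/
theorem tendsto_sum_monomial {a : ℕ → ℂ} (ha : ∀ z ∈ Disc, Summable fun k => a k * z ^ k) :
    Filter.Tendsto (fun N => ∑ k ∈ Finset.range N, a k • monomial k) Filter.atTop
      (nhds (ofCoeff a)) := by
  rw [tendsto_iff]
  intro K hK
  obtain ⟨r, hr0, hr1, hr⟩ : ∃ r : ℝ, 0 ≤ r ∧ r < 1 ∧ ∀ z ∈ K, ‖(z : ℂ)‖ ≤ r := by
    rcases K.eq_empty_or_nonempty with rfl | hne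
    · exact ⟨0, le_rfl, one_pos, by simp⟩
    · obtain ⟨w, hw, hmax⟩ := hK.exists_isMaxOn hne
        (f := fun z : Disc => ‖(z : ℂ)‖) (by fun_prop)
      exact ⟨‖(w : ℂ)‖, norm_nonneg _, mem_ball_zero_iff.1 w.2, fun z hz => hmax hz⟩
  have hrd : (r : ℂ) ∈ Disc := by
    rw [mem_ball_zero_iff, norm_real, Real.norm_of_nonneg hr0]
    exact hr1
  have h := tendstoUniformlyOn_tsum_nat (s := K) (f := fun k (z : Disc) => a k * (z : ℂ) ^ k)
    (ha _ hrd).norm fun k z hz => by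
      rw [norm_mul, norm_mul, norm_pow, norm_pow, norm_real, Real.norm_of_nonneg hr0]
      gcongr
      exact hr z hz
  convert! h using 1
  · funext N z
    rw [← eval_coe]
    have : eval (∑ k ∈ Finset.range N, a k • monomial k) z =
        ∑ k ∈ Finset.range N, eval (a k • monomial k) z := by
      induction N with
      | zero => simp [eval, extZero_of_mem _ z.2]
      | succ N ih => rw [Finset.sum_range_succ, Finset.sum_range_succ, eval_add _ _ z.2, ih]
    rw [this]
    refine Finset.sum_congr rfl fun k _ => ?_
    rw [eval_smul _ _ z.2, monomial, eval_mk _ _ z.2]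
  · funext z
    rw [← eval_coe, ofCoeff, dif_pos ha, eval_mk _ _ z.2]

theorem aemeasurable_ofCoeff {μ : Measure (ℕ → ℂ)}
    (h : ∀ᵐ a ∂μ, ∀ z ∈ Disc, Summable fun k => a k * z ^ k) : AEMeasurable ofCoeff μ := by
  refine aemeasurable_of_tendsto_metrizable_ae (u := Filter.atTop)
    (f := fun (N : ℕ) (a : ℕ → ℂ) => ∑ k ∈ Finset.range N, a k • monomial k) (fun N => ?_) ?_
  · refine Measurable.aemeasurable ?_
    exact (continuous_finsetSum _ fun k _ =>
      (continuous_apply k).smul continuous_const).measurable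
  · filter_upwards [h] with a ha
    exact tendsto_sum_monomial ha

end Hol

/-! ### Second moments of Gaussian Taylor coefficients and convergence of the random series. -/

section Moments

theorem measurePreserving_re_complexGaussian (v : ℝ≥0) :
    MeasurePreserving re (complexGaussian v) (gaussianReal 0 v) :=
  measurePreserving_fst.comp
    ((measurableEquivRealProd.symm.measurable.measurePreserving _).symm measurableEquivRealProd.symm)

theorem measurePreserving_im_complexGaussian (v : ℝ≥0) :
    MeasurePreserving im (complexGaussian v) (gaussianReal 0 v) :=
  measurePreserving_snd.comp
    ((measurableEquivRealProd.symm.measurable.measurePreserving _).symm measurableEquivRealProd.symm)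

theorem memLp_re_complexGaussian (v : ℝ≥0) : MemLp re 2 (complexGaussian v) :=
  (memLp_id_gaussianReal 2).comp_measurePreserving (measurePreserving_re_complexGaussian v)

theorem memLp_im_complexGaussian (v : ℝ≥0) : MemLp im 2 (complexGaussian v) :=
  (memLp_id_gaussianReal 2).comp_measurePreserving (measurePreserving_im_complexGaussian v)

theorem memLp_id_complexGaussian (v : ℝ≥0) : MemLp (fun z : ℂ => z) 2 (complexGaussian v) := by
  have h := (memLp_re_complexGaussian v).ofReal (K := ℂ) |>.add
    ((memLp_im_complexGaussian v).ofReal (K := ℂ) |>.mul_const I)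
  refine h.congr_norm (by fun_prop) (Filter.Eventually.of_forall fun z => ?_)
  exact congrArg _ (re_add_im z)

theorem integral_id_complexGaussian (v : ℝ≥0) : ∫ z, z ∂complexGaussian v = 0 := by
  have hi : Integrable (fun z : ℂ => z) (complexGaussian v) :=
    (memLp_id_complexGaussian v).integrable one_le_two
  have hre : ∫ z, re z ∂complexGaussian v = 0 := by
    rw [← integral_id_gaussianReal (μ := 0) (v := v),
      ← (measurePreserving_re_complexGaussian v).map_eq,
      integral_map measurable_re.aemeasurable (by fun_prop)]
  have him : ∫ z, im z ∂complexGaussian v = 0 := by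
    rw [← integral_id_gaussianReal (μ := 0) (v := v),
      ← (measurePreserving_im_complexGaussian v).map_eq,
      integral_map measurable_im.aemeasurable (by fun_prop)]
  have h := integral_re_add_im hi
  simp only [RCLike.re_to_complex, RCLike.im_to_complex, hre, him] at h
  simpa using h.symm

theorem integral_sq_gaussianReal (v : ℝ≥0) : ∫ x, x ^ 2 ∂gaussianReal 0 v = v := by
  have h := variance_of_integral_eq_zero (X := id) (μ := gaussianReal 0 v) aemeasurable_id
    (by simp)
  rw [variance_id_gaussianReal] at h
  exact h.symm

theorem integral_conj_mul_complexGaussian (v : ℝ≥0) :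
    ∫ z, conj z * z ∂complexGaussian v = (2 * v : ℝ) := by
  have h1 := (memLp_re_complexGaussian v).integrable_sq
  have h2 := (memLp_im_complexGaussian v).integrable_sq
  have e : ∀ z : ℂ, conj z * z = ((re z ^ 2 + im z ^ 2 : ℝ) : ℂ) := fun z => by
    rw [← normSq_eq_conj_mul_self, normSq_apply]
    ring_nf
  have hre : ∫ z, re z ^ 2 ∂complexGaussian v = v := by
    rw [← integral_sq_gaussianReal v,
      ← (measurePreserving_re_complexGaussian v).map_eq,
      integral_map measurable_re.aemeasurable (by fun_prop)]
  have him : ∫ z, im z ^ 2 ∂complexGaussian v = v := by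
    rw [← integral_sq_gaussianReal v,
      ← (measurePreserving_im_complexGaussian v).map_eq,
      integral_map measurable_im.aemeasurable (by fun_prop)]
  simp only [e]
  rw [integral_complex_ofReal, integral_add h1 h2, hre, him, two_mul]

instance (m T : ℝ) : IsProbabilityMeasure (gaussianCoeff m T) := by
  unfold gaussianCoeff
  infer_instance

theorem memLp_eval_gaussianCoeff (m T : ℝ) (i : ℕ) :
    MemLp (fun a : ℕ → ℂ => a i) 2 (gaussianCoeff m T) :=
  (memLp_id_complexGaussian _).comp_measurePreserving
    (measurePreserving_eval_infinitePi (fun k => complexGaussian (T / wt m k).toNNReal) i)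

theorem integrable_conj_mul_gaussianCoeff (m T : ℝ) (i j : ℕ) :
    Integrable (fun a : ℕ → ℂ => conj (a i) * a j) (gaussianCoeff m T) :=
  (memLp_eval_gaussianCoeff m T i).star.integrable_mul (memLp_eval_gaussianCoeff m T j)

theorem integral_conj_mul_gaussianCoeff {m T : ℝ} (hm : 0 < m) (hT : 0 < T) (i j : ℕ) :
    ∫ a, conj (a i) * a j ∂gaussianCoeff m T = if i = j then ((2 * T * (wt m i)⁻¹ : ℝ) : ℂ) else 0 := by
  split_ifs with h
  · subst h
    have h1 := (measurePreserving_eval_infinitePi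
      (fun k => complexGaussian (T / wt m k).toNNReal) i)
    have h2 := integral_conj_mul_complexGaussian (T / wt m i).toNNReal
    rw [← h1.map_eq, integral_map h1.measurable.aemeasurable (by fun_prop),
      Real.coe_toNNReal _ (div_nonneg hT.le (wt_pos hm i).le)] at h2
    rw [mul_assoc, ← div_eq_mul_inv]
    exact h2
  · have h1 := Measure.infinitePi_map_eval_prod
      (P := fun k => complexGaussian (T / wt m k).toNNReal) h
    have h2 := integral_prod_mul (μ := complexGaussian (T / wt m i).toNNReal)
      (ν := complexGaussian (T / wt m j).toNNReal) (fun z => conj z) fun z => z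
    rw [integral_id_complexGaussian, mul_zero, ← h1, integral_map
      (by fun_prop) (by fun_prop)] at h2
    exact h2

/-- The second moment of a linear combination of orthogonal random variables. -/
theorem integral_norm_sum_sq {Ω ι : Type*} [MeasurableSpace Ω] [DecidableEq ι] {μ : Measure Ω}
    {X : ι → Ω → ℂ} {σ : ι → ℝ} (hX : ∀ i j, Integrable (fun ω => conj (X i ω) * X j ω) μ)
    (h : ∀ i j, ∫ ω, conj (X i ω) * X j ω ∂μ = if i = j then (σ i : ℂ) else 0)
    (s : Finset ι) (c : ι → ℂ) :
    Integrable (fun ω => ‖∑ i ∈ s, c i * X i ω‖ ^ 2) μ ∧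
      ∫ ω, ‖∑ i ∈ s, c i * X i ω‖ ^ 2 ∂μ = ∑ i ∈ s, ‖c i‖ ^ 2 * σ i := by
  have e : ∀ ω, ((‖∑ i ∈ s, c i * X i ω‖ ^ 2 : ℝ) : ℂ) =
      ∑ i ∈ s, ∑ j ∈ s, (conj (c i) * c j) * (conj (X i ω) * X j ω) := fun ω => by
    rw [ofReal_pow, ← conj_mul', map_sum, Finset.sum_mul_sum]
    refine Finset.sum_congr rfl fun i _ => Finset.sum_congr rfl fun j _ => ?_
    rw [map_mul]
    ring
  have hi : ∀ i ∈ s, Integrable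
      (fun ω => ∑ j ∈ s, (conj (c i) * c j) * (conj (X i ω) * X j ω)) μ := fun i _ =>
    integrable_finsetSum _ fun j _ => (hX i j).const_mul _
  have hint : Integrable (fun ω => ((‖∑ i ∈ s, c i * X i ω‖ ^ 2 : ℝ) : ℂ)) μ := by
    simp only [e]
    exact integrable_finsetSum _ hi
  refine ⟨by simpa only [RCLike.re_to_complex, ofReal_re] using hint.re, ?_⟩
  rw [← ofReal_inj, ← integral_complex_ofReal]
  simp only [e]
  rw [integral_finsetSum _ hi, ofReal_sum]
  refine Finset.sum_congr rfl fun i his => ?_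
  rw [integral_finsetSum _ fun j _ => (hX i j).const_mul _]
  simp only [integral_const_mul, h, mul_ite, mul_zero, Finset.sum_ite_eq, his, if_true]
  rw [conj_mul']
  push_cast
  ring

end Moments

theorem ae_summable_gaussianCoeff {m T : ℝ} (hm : 0 < m) (hT : 0 < T) :
    ∀ᵐ a ∂gaussianCoeff m T, ∀ z ∈ Disc, Summable fun k => a k * z ^ k := by
  have key : ∀ r : ℝ, 0 < r → r < 1 →
      ∀ᵐ a ∂gaussianCoeff m T, Summable fun k => ‖a k‖ * r ^ k := fun r h0 h1 => by
    have hsq : ∀ k, Integrable (fun a : ℕ → ℂ => ‖a k‖ ^ 2) (gaussianCoeff m T) ∧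
        ∫ a, ‖a k‖ ^ 2 ∂gaussianCoeff m T = 2 * T * (wt m k)⁻¹ := fun k => by
      have := integral_norm_sum_sq (X := fun k (a : ℕ → ℂ) => a k)
        (integrable_conj_mul_gaussianCoeff m T) (integral_conj_mul_gaussianCoeff hm hT) {k} 1
      simpa using this
    have hw : ∀ k, 0 < √(wt m k) := fun k => Real.sqrt_pos.2 (wt_pos hm k)
    have hmeas : ∀ k, Measurable fun a : ℕ → ℂ =>
        ENNReal.ofReal (√(wt m k) * r ^ k * ‖a k‖ ^ 2) := fun k =>
      (((measurable_pi_apply k).norm.pow_const 2).const_mul _).ennreal_ofReal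
    -- Since `E|a_k|² = 2T / wt m k`, the factor `√(wt m k)` turns the expectation into the
    -- convergent series of `summable_wt`.
    have hlint : ∫⁻ a, ∑' k, ENNReal.ofReal (√(wt m k) * r ^ k * ‖a k‖ ^ 2) ∂gaussianCoeff m T
        ≠ ⊤ := by
      rw [lintegral_tsum fun k => (hmeas k).aemeasurable]
      have e : ∀ k, ∫⁻ a, ENNReal.ofReal (√(wt m k) * r ^ k * ‖a k‖ ^ 2) ∂gaussianCoeff m T =
          ENNReal.ofReal (2 * T * ((√(wt m k))⁻¹ * r ^ k)) := fun k => by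
        rw [← ofReal_integral_eq_lintegral_ofReal ((hsq k).1.const_mul _)
          (Filter.Eventually.of_forall fun a => by have := hw k; positivity), integral_const_mul,
          (hsq k).2]
        congr 1
        have h2 := Real.sq_sqrt (wt_pos hm k).le
        have h3 := hw k
        rw [← h2]
        field_simp
        rw [h2, h2]
      simp only [e]
      exact ((summable_wt hm h0 h1).mul_left (2 * T)).tsum_ofReal_ne_top
    filter_upwards [ae_lt_top (Measurable.tsum hmeas) hlint] with a ha
    have hs : Summable fun k => √(wt m k) * r ^ k * ‖a k‖ ^ 2 := by
      have := ENNReal.summable_toReal ha.ne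
      refine this.congr fun k => ENNReal.toReal_ofReal ?_
      have := hw k
      positivity
    refine (hs.add (summable_wt hm h0 h1)).of_nonneg_of_le (fun k => by positivity) fun k => ?_
    have h3 := hw k
    have hr : 0 < r ^ k := pow_pos h0 k
    have : ‖a k‖ ≤ √(wt m k) * ‖a k‖ ^ 2 + (√(wt m k))⁻¹ := by
      rw [← sub_nonneg]
      have : √(wt m k) * ‖a k‖ ^ 2 + (√(wt m k))⁻¹ - ‖a k‖ =
          (√(wt m k))⁻¹ * ((√(wt m k) * ‖a k‖ - 1 / 2) ^ 2 + 3 / 4) := by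
        field_simp
        ring
      rw [this]
      positivity
    nlinarith
  -- Countably many radii tending to `1` give one null set for the whole disc; the shift by `2`
  -- keeps the radius positive at `j = 0`.
  have hall : ∀ᵐ a ∂gaussianCoeff m T, ∀ j : ℕ,
      Summable fun k => ‖a k‖ * (1 - 1 / ((j : ℝ) + 2)) ^ k := by
    rw [ae_all_iff]
    intro j
    have h2 : (0 : ℝ) < (j : ℝ) + 2 := by positivity
    refine key _ ?_ ?_
    · rw [sub_pos, div_lt_one h2]
      linarith [(Nat.cast_nonneg j : (0 : ℝ) ≤ j)]
    · have : 0 < 1 / ((j : ℝ) + 2) := by positivity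
      linarith
  filter_upwards [hall] with a ha z hz
  have hz' : ‖z‖ < 1 := mem_ball_zero_iff.1 hz
  obtain ⟨j, hj⟩ := exists_nat_one_div_lt (sub_pos.2 hz')
  refine (ha j).of_norm_bounded fun k => ?_
  rw [norm_mul, norm_pow]
  have : 1 / ((j : ℝ) + 2) ≤ 1 / ((j : ℝ) + 1) :=
    one_div_le_one_div_of_le (by positivity) (by linarith)
  gcongr
  linarith

/-! ### The multiplicative image measure and its Fourier transform. -/

section ProductMeasure

variable {m n S T : ℝ}

theorem aemeasurable_ofCoeff_gaussianCoeff (hm : 0 < m) (hT : 0 < T) :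
    AEMeasurable Hol.ofCoeff (gaussianCoeff m T) :=
  Hol.aemeasurable_ofCoeff (ae_summable_gaussianCoeff hm hT)

theorem aemeasurable_mul_comp {α β : Type*} [MeasurableSpace α] [MeasurableSpace β]
    {μ : Measure α} {ν : Measure β} [SFinite μ] [SFinite ν] {f : α → Hol} {g : β → Hol}
    (hf : AEMeasurable f μ) (hg : AEMeasurable g ν) :
    AEMeasurable (fun p : α × β => Hol.mul (f p.1) (g p.2)) (μ.prod ν) :=
  Hol.continuous_mul.measurable.comp_aemeasurable
    ((hf.comp_quasiMeasurePreserving Measure.quasiMeasurePreserving_fst).prodMk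
      (hg.comp_quasiMeasurePreserving Measure.quasiMeasurePreserving_snd))

theorem aemeasurable_mul_ofCoeff (hm : 0 < m) (hn : 0 < n) (hS : 0 < S) (hT : 0 < T) :
    AEMeasurable (fun p : (ℕ → ℂ) × (ℕ → ℂ) => Hol.mul (Hol.ofCoeff p.1) (Hol.ofCoeff p.2))
      ((gaussianCoeff m S).prod (gaussianCoeff n T)) :=
  aemeasurable_mul_comp (aemeasurable_ofCoeff_gaussianCoeff hm hS)
    (aemeasurable_ofCoeff_gaussianCoeff hn hT)

theorem mulMeasure_gaussian (hm : 0 < m) (hn : 0 < n) (hS : 0 < S) (hT : 0 < T) :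
    mulMeasure (gaussian m S) (gaussian n T) =
      ((gaussianCoeff m S).prod (gaussianCoeff n T)).map
        fun p => Hol.mul (Hol.ofCoeff p.1) (Hol.ofCoeff p.2) := by
  have h1 := aemeasurable_ofCoeff_gaussianCoeff hm hS
  have h2 := aemeasurable_ofCoeff_gaussianCoeff hn hT
  -- `Hol.ofCoeff` is known to be measurable only almost everywhere, so measurable modifications
  -- replace it before the product of images is formed.
  rw [mulMeasure, gaussian, gaussian, Measure.map_congr h1.ae_eq_mk, Measure.map_congr h2.ae_eq_mk,
    Measure.map_prod_map _ _ h1.measurable_mk h2.measurable_mk,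
    Measure.map_map Hol.continuous_mul.measurable
      (h1.measurable_mk.prodMap h2.measurable_mk)]
  refine Measure.map_congr ?_
  filter_upwards [Measure.quasiMeasurePreserving_fst.ae h1.ae_eq_mk,
    Measure.quasiMeasurePreserving_snd.ae h2.ae_eq_mk] with p hp hq
  simp only [Function.comp_apply, Prod.map_fst, Prod.map_snd, ← hp, ← hq]

theorem isProbabilityMeasure_mulMeasure_gaussian (hm : 0 < m) (hn : 0 < n) (hS : 0 < S)
    (hT : 0 < T) : IsProbabilityMeasure (mulMeasure (gaussian m S) (gaussian n T)) := by
  rw [mulMeasure_gaussian hm hn hS hT]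
  exact Measure.isProbabilityMeasure_map (aemeasurable_mul_ofCoeff hm hn hS hT)

/-- The finite set of the degrees that occur in a polynomial differential. -/
def algSupport (F : algSet m) : Finset ℕ :=
  Set.Finite.toFinset (s := {k | (HL2.toHol m F).coeff k ≠ 0}) F.2

theorem pairing_eq_sum (F : algSet m) (f : Hol) :
    pairing m F f = ∑ k ∈ algSupport F,
      wt m k * ((HL2.toHol m F).coeff k * conj (f.coeff k)) := by
  refine finsum_eq_sum_of_support_subset _ fun k hk => ?_
  refine (Set.Finite.mem_toFinset _).2 fun h => hk ?_
  simp only [h, zero_mul, mul_zero]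

theorem measurable_pairing (F : algSet m) : Measurable (pairing m F) := by
  have : pairing m F = fun f => ∑ k ∈ algSupport F,
      wt m k * ((HL2.toHol m F).coeff k * conj (f.coeff k)) := funext (pairing_eq_sum F)
  rw [this]
  exact (continuous_finsetSum _ fun k _ => continuous_const.mul
    (continuous_const.mul (continuous_conj.comp (Hol.continuous_coeff k)))).measurable

/-- The pairing is conjugate linear in `f`; conjugating inside the norm exhibits it as a linear
combination of the products `a_i b_j`, each occurring once because antidiagonals are disjoint. -/
theorem norm_pairing_mul_ofCoeff (F : algSet (m + n)) {a b : ℕ → ℂ}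
    (ha : ∀ z ∈ Disc, Summable fun k => a k * z ^ k)
    (hb : ∀ z ∈ Disc, Summable fun k => b k * z ^ k) :
    ‖pairing (m + n) F (Hol.mul (Hol.ofCoeff a) (Hol.ofCoeff b))‖ =
      ‖∑ p ∈ (algSupport F).biUnion antidiagonal,
        (wt (m + n) (p.1 + p.2) * conj ((HL2.toHol (m + n) F).coeff (p.1 + p.2))) *
          (a p.1 * b p.2)‖ := by
  rw [← RCLike.norm_conj, pairing_eq_sum, map_sum, Finset.sum_biUnion]
  · congr 1
    refine Finset.sum_congr rfl fun k _ => ?_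
    rw [Hol.coeff_mul, Hol.coeff_ofCoeff ha, Hol.coeff_ofCoeff hb]
    simp only [map_mul, conj_conj, conj_ofReal, Finset.mul_sum]
    refine Finset.sum_congr rfl fun p hp => ?_
    rw [mem_antidiagonal.1 hp]
    ring
  · intro k _ l _ hkl
    rw [Function.onFun, Finset.disjoint_left]
    intro p hp hq
    exact hkl ((mem_antidiagonal.1 hp).symm.trans (mem_antidiagonal.1 hq))

theorem algSet_sub (F G : algSet m) : (F : HL2 m) - G ∈ algSet m := by
  refine (F.2.union G.2).subset fun k hk => ?_
  rw [Set.mem_union]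
  by_contra h
  push Not at h
  refine hk ?_
  have h1 : (HL2.toHol m F).coeff k = 0 := by simpa using h.1
  have h2 : (HL2.toHol m G).coeff k = 0 := by simpa using h.2
  rw [sub_eq_add_neg, ← neg_one_smul ℂ, map_add, map_smul, Hol.coeff_add, Hol.coeff_smul, h1, h2]
  simp

theorem pairing_sub (F G : algSet m) (f : Hol) :
    pairing m ((F : HL2 m) - G) f = pairing m F f - pairing m G f := by
  rw [pairing, pairing, pairing, ← finsum_sub_distrib]
  · refine finsum_congr fun k => ?_
    rw [sub_eq_add_neg (F : HL2 m), ← neg_one_smul ℂ (G : HL2 m), map_add, map_smul, Hol.coeff_add,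
      Hol.coeff_smul]
    ring
  · refine F.2.subset fun k hk h => hk ?_
    simp only [h, zero_mul, mul_zero]
  · refine G.2.subset fun k hk h => hk ?_
    simp only [h, zero_mul, mul_zero]

theorem norm_exp_neg_I_mul_sub_le (x y : ℝ) :
    ‖exp (-I * (x : ℂ)) - exp (-I * (y : ℂ))‖ ≤ |x - y| := by
  have h : exp (-I * (x : ℂ)) - exp (-I * (y : ℂ)) =
      exp (((-y : ℝ) : ℂ) * I) * (exp (I * ((y - x : ℝ) : ℂ)) - 1) := by
    rw [mul_sub, ← exp_add, mul_one]
    push_cast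
    ring_nf
  rw [h, norm_mul, norm_exp_ofReal_mul_I, one_mul, abs_sub_comm]
  exact Real.norm_exp_I_mul_ofReal_sub_one_le

variable [hm : Fact (0 < m)] [hn : Fact (0 < n)]

/-- The products `a_i b_j` are orthogonal with second moments `(2S / wt m i) (2T / wt n j)`, whose
sum over `i + j = k` is `4ST / wt (m + n) k`. This cancels one of the two factors `wt (m + n) k`
coming from the pairing. -/
theorem integral_norm_pairing_sq_le (hS : 0 < S) (hT : 0 < T) (F : algSet (m + n)) :
    Integrable (fun f => ‖pairing (m + n) F f‖ ^ 2) (mulMeasure (gaussian m S) (gaussian n T)) ∧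
      ∫ f, ‖pairing (m + n) F f‖ ^ 2 ∂mulMeasure (gaussian m S) (gaussian n T) ≤
        4 * S * T * ‖(F : HL2 (m + n))‖ ^ 2 := by
  set c : ℕ × ℕ → ℂ := fun p =>
    wt (m + n) (p.1 + p.2) * conj ((HL2.toHol (m + n) F).coeff (p.1 + p.2)) with hc
  set σ : ℕ × ℕ → ℝ := fun p => (2 * S * (wt m p.1)⁻¹) * (2 * T * (wt n p.2)⁻¹) with hσ
  have e : ∀ (p q : ℕ × ℕ) (ω : (ℕ → ℂ) × (ℕ → ℂ)),
      conj (ω.1 p.1 * ω.2 p.2) * (ω.1 q.1 * ω.2 q.2) =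
        (conj (ω.1 p.1) * ω.1 q.1) * (conj (ω.2 p.2) * ω.2 q.2) := fun p q ω => by
    rw [map_mul]
    ring
  have hX := integral_norm_sum_sq (μ := (gaussianCoeff m S).prod (gaussianCoeff n T))
    (X := fun (p : ℕ × ℕ) (ω : (ℕ → ℂ) × (ℕ → ℂ)) => ω.1 p.1 * ω.2 p.2) (σ := σ)
    (fun p q => by
      simp only [e]
      exact (integrable_conj_mul_gaussianCoeff m S p.1 q.1).mul_prod
        (integrable_conj_mul_gaussianCoeff n T p.2 q.2))
    (fun p q => by
      simp only [e]
      rw [integral_prod_mul (fun a : ℕ → ℂ => conj (a p.1) * a q.1)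
        fun b : ℕ → ℂ => conj (b p.2) * b q.2, integral_conj_mul_gaussianCoeff hm.out hS,
        integral_conj_mul_gaussianCoeff hn.out hT]
      obtain ⟨i, j⟩ := p
      obtain ⟨k, l⟩ := q
      simp only [Prod.mk.injEq]
      by_cases h1 : i = k <;> by_cases h2 : j = l <;> simp [h1, h2, hσ])
    ((algSupport F).biUnion antidiagonal) c
  have hmeas := aemeasurable_mul_ofCoeff hm.out hn.out hS hT
  have hsm : AEStronglyMeasurable (fun f => ‖pairing (m + n) F f‖ ^ 2)
      (((gaussianCoeff m S).prod (gaussianCoeff n T)).map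
        fun p => Hol.mul (Hol.ofCoeff p.1) (Hol.ofCoeff p.2)) :=
    ((measurable_pairing F).norm.pow_const 2).aestronglyMeasurable
  have hae : (fun ω : (ℕ → ℂ) × (ℕ → ℂ) =>
      ‖∑ p ∈ (algSupport F).biUnion antidiagonal, c p * (ω.1 p.1 * ω.2 p.2)‖ ^ 2)
      =ᵐ[(gaussianCoeff m S).prod (gaussianCoeff n T)]
      fun ω => ‖pairing (m + n) F (Hol.mul (Hol.ofCoeff ω.1) (Hol.ofCoeff ω.2))‖ ^ 2 := by
    filter_upwards [Measure.quasiMeasurePreserving_fst.ae (ae_summable_gaussianCoeff hm.out hS),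
      Measure.quasiMeasurePreserving_snd.ae (ae_summable_gaussianCoeff hn.out hT)] with ω h1 h2
    rw [norm_pairing_mul_ofCoeff F h1 h2]
  rw [mulMeasure_gaussian hm.out hn.out hS hT]
  refine ⟨(integrable_map_measure hsm hmeas).2 (hX.1.congr hae), ?_⟩
  rw [integral_map hmeas hsm, ← integral_congr_ae hae, hX.2, Finset.sum_biUnion]
  · calc _ = ∑ k ∈ algSupport F, 4 * S * T *
          (wt (m + n) k * ‖(HL2.toHol (m + n) F).coeff k‖ ^ 2) := by
          refine Finset.sum_congr rfl fun k _ => ?_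
          have hk := wt_pos (add_pos hm.out hn.out) k
          have e1 : ∀ p ∈ antidiagonal k, ‖c p‖ ^ 2 * σ p =
              4 * S * T * (wt (m + n) k ^ 2 * ‖(HL2.toHol (m + n) F).coeff k‖ ^ 2) *
                ((wt m p.1)⁻¹ * (wt n p.2)⁻¹) := fun p hp => by
            rw [hc, hσ]
            simp only [mem_antidiagonal.1 hp, norm_mul, norm_real, RCLike.norm_conj,
              Real.norm_of_nonneg hk.le]
            ring
          rw [Finset.sum_congr rfl e1, ← Finset.mul_sum, sum_inv_wt_mul_inv_wt hm.out hn.out]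
          field_simp
      _ ≤ _ := by
          rw [← Finset.mul_sum]
          refine mul_le_mul_of_nonneg_left ?_ (by positivity)
          refine sum_le_hasSum _ (fun k _ => ?_) (HL2.norm_sq_eq (F : HL2 (m + n)))
          have hk := wt_pos (add_pos hm.out hn.out) k
          positivity
  · intro k _ l _ hkl
    rw [Function.onFun, Finset.disjoint_left]
    intro p hp hq
    exact hkl ((mem_antidiagonal.1 hp).symm.trans (mem_antidiagonal.1 hq))

theorem integral_norm_pairing_le (hS : 0 < S) (hT : 0 < T) (F : algSet (m + n)) :
    Integrable (fun f => ‖pairing (m + n) F f‖) (mulMeasure (gaussian m S) (gaussian n T)) ∧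
      ∫ f, ‖pairing (m + n) F f‖ ∂mulMeasure (gaussian m S) (gaussian n T) ≤
        2 * √(S * T) * ‖(F : HL2 (m + n))‖ := by
  have := isProbabilityMeasure_mulMeasure_gaussian hm.out hn.out hS hT
  obtain ⟨h1, h2⟩ := integral_norm_pairing_sq_le hS hT F
  have hmem : MemLp (fun f => ‖pairing (m + n) F f‖) 2
      (mulMeasure (gaussian m S) (gaussian n T)) :=
    (memLp_two_iff_integrable_sq (measurable_pairing F).norm.aestronglyMeasurable).2 h1
  refine ⟨hmem.integrable one_le_two, le_of_sq_le_sq ?_ (by positivity)⟩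
  -- Nonnegativity of the variance bounds the squared mean by the second moment.
  have hv := variance_nonneg (fun f => ‖pairing (m + n) F f‖)
    (mulMeasure (gaussian m S) (gaussian n T))
  rw [variance_eq_sub hmem] at hv
  have h3 : (2 * √(S * T) * ‖(F : HL2 (m + n))‖) ^ 2 = 4 * S * T * ‖(F : HL2 (m + n))‖ ^ 2 := by
    rw [mul_pow, mul_pow, Real.sq_sqrt (mul_pos hS hT).le]
    ring
  rw [h3]
  simp only [Pi.pow_apply] at hv
  linarith

/-- Integrate `|exp(-ix) - exp(-iy)| ≤ |x - y|` and apply the first moment bound to the difference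
`F - G`, again a polynomial. -/
theorem lipschitzWith_fourier (hS : 0 < S) (hT : 0 < T) :
    LipschitzWith (2 * √(S * T)).toNNReal
      (fourier (m + n) (mulMeasure (gaussian m S) (gaussian n T))) := by
  have := isProbabilityMeasure_mulMeasure_gaussian hm.out hn.out hS hT
  refine LipschitzWith.of_dist_le_mul fun F G => ?_
  have hint : ∀ F : algSet (m + n), Integrable
      (fun f => exp (-I * ((pairing (m + n) F f).re : ℂ)))
      (mulMeasure (gaussian m S) (gaussian n T)) := fun F => by
    refine Integrable.of_bound (C := 1) ?_ (Filter.Eventually.of_forall fun f => ?_)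
    · have := measurable_pairing F
      refine Measurable.aestronglyMeasurable ?_
      fun_prop
    · rw [show -I * ((pairing (m + n) F f).re : ℂ) = ((-(pairing (m + n) F f).re : ℝ) : ℂ) * I by
        push_cast; ring, norm_exp_ofReal_mul_I]
  obtain ⟨h1, h2⟩ := integral_norm_pairing_le hS hT ⟨_, algSet_sub F G⟩
  rw [dist_eq_norm, fourier, fourier, ← integral_sub (hint F) (hint G), Real.coe_toNNReal _
    (by positivity), Subtype.dist_eq, dist_eq_norm]
  refine (norm_integral_le_of_norm_le h1 (Filter.Eventually.of_forall fun f => ?_)).trans h2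
  refine (norm_exp_neg_I_mul_sub_le _ _).trans ?_
  rw [pairing_sub, ← sub_re]
  exact abs_re_le_norm _

theorem dense_algSet : Dense (algSet m) := by
  have h := (Submodule.dense_iff_topologicalClosure_eq_top).2 (HL2.monomialBasis m).dense_span
  refine h.mono fun F hF => ?_
  induction hF using Submodule.span_induction with
  | mem F hF =>
    obtain ⟨i, rfl⟩ := hF
    refine (Set.finite_singleton i).subset fun k hk => ?_
    by_contra hki
    exact hk (by rw [HL2.coeff_monomialBasis, if_neg (by simpa using hki)])
  | zero =>
    refine Set.finite_empty.subset fun k hk => hk ?_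
    rw [map_zero, Hol.coeff_zero]
  | add F G _ _ hF hG =>
    refine (Set.Finite.union hF hG).subset fun k hk => ?_
    rw [Set.mem_union]
    by_contra h
    push Not at h
    have h1 : (HL2.toHol m F).coeff k = 0 := by simpa using h.1
    have h2 : (HL2.toHol m G).coeff k = 0 := by simpa using h.2
    exact hk (by rw [map_add, Hol.coeff_add, h1, h2, add_zero])
  | smul c F _ hF =>
    refine Set.Finite.subset hF fun k hk h => hk ?_
    rw [map_smul, Hol.coeff_smul, h, mul_zero]

theorem existsUnique_continuous_extension_fourier (hS : 0 < S) (hT : 0 < T) :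
    ∃! Φ : C(HL2 (m + n), ℂ), ∀ F : algSet (m + n),
      Φ F = fourier (m + n) (mulMeasure (gaussian m S) (gaussian n T)) F := by
  have hd : DenseRange (Subtype.val : algSet (m + n) → HL2 (m + n)) := dense_algSet.denseRange_val
  have hi : IsUniformInducing (Subtype.val : algSet (m + n) → HL2 (m + n)) :=
    isUniformInducing_val _
  have hf := (lipschitzWith_fourier (m := m) (n := n) hS hT).uniformContinuous
  refine ⟨⟨_, (uniformContinuous_uniformly_extend hi hd hf).continuous⟩,
    fun F => uniformly_extend_of_ind hi hd hf F, fun Ψ hΨ => ?_⟩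
  refine ContinuousMap.ext fun F => ?_
  exact congrFun (uniformly_extend_unique hi hd hΨ Ψ.continuous).symm F

end ProductMeasure

end

end HoloDiff

theorem mainTheorem5 (m n : ℝ) [Fact (0 < m)] [Fact (0 < n)] :
    -- the embedding `F ↦ B(m,n;F)` is well defined
    (∃! J, HoloDiff.IsEquivariantEmbedding m n J) ∧
    -- (a), including the convergence of the Fredholm determinant
    (∀ F : HoloDiff.HL2 (m + n), Summable fun s : Finset ℕ =>
      HoloDiff.principalMinor (HoloDiff.HL2.monomialBasis n)
        (HoloDiff.mulStar (HoloDiff.genHankel m n F)) s) ∧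
    (∀ j : ℕ, 1 ≤ j → HoloDiff.IsPositiveDefinite fun F : HoloDiff.HL2 (m + n) =>
      (HoloDiff.detB m n F ^ j)⁻¹) ∧
    -- (b)
    (∀ S T : ℝ, 0 < S → 0 < T →
      MeasureTheory.IsProbabilityMeasure
        (HoloDiff.mulMeasure (HoloDiff.gaussian m S) (HoloDiff.gaussian n T)) ∧
      ∃! Φ : C(HoloDiff.HL2 (m + n), ℂ), ∀ F : HoloDiff.algSet (m + n),
        Φ F = HoloDiff.fourier (m + n)
          (HoloDiff.mulMeasure (HoloDiff.gaussian m S) (HoloDiff.gaussian n T)) F) := by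
  refine ⟨HoloDiff.HL2.existsUnique_isEquivariantEmbedding,
    HoloDiff.HL2.summable_principalMinor_genHankel,
    fun j _ => HoloDiff.HL2.isPositiveDefinite_detB_pow_inv j, fun S T hS hT => ?_⟩
  exact ⟨HoloDiff.isProbabilityMeasure_mulMeasure_gaussian Fact.out Fact.out hS hT,
    HoloDiff.existsUnique_continuous_extension_fourier hS hT⟩
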